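/- Let $\mathcal X\subset\mathbb R^d$ be compact and let $\eta(s)=\max_{i\ge1}\zeta_iY_i(s)$, $s\in\mathcal X$, be a simple max-stable process: $\{\zeta_i\}$ are the points of a Poisson process on $(0,\infty)$ with intensity $\zeta^{-2}\,d\zeta$ and, independently of it, $Y_1,Y_2,\dots$ are independent copies of a nonnegative process $Y$ on $\mathcal X$ with continuous sample paths, $\mathbb E\,Y(s)=1$ for all $s\in\mathcal X$ and $\mathbb E\sup_{s\in\mathcal X}Y(s)<\infty$. Fix $k\ge2$ sites $s_1,\dots,s_k\in\mathcal X$ and let $$p=\mathbb P\{\text{for some }\ell\ge1:\ \eta(s_j)=\zeta_\ell Y_\ell(s_j),\ j=1,\dots,k\}$$ be the extremal concurrence probability. Let $X_1,X_2,\dots$ be independent random vectors in $\mathbb R^k$, each distributed as $(h_1(\eta(s_1)),\dots,h_k(\eta(s_k)))$, where $h_1,\dots,h_k$ are strictly increasing functions on $(0,\infty)$ (the identity if the observed max-stable process is itself simple). For $m\ge1$ let $p_m$ be the probability that one of the vectors $X_1,\dots,X_m$ is componentwise greater than or equal to all of $X_1,\dots,X_m$, and for $n\ge m$ let $$\hat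 p_m=\frac1{[n/m]}\sum_{b=1}^{[n/m]}\ \max_{\ell=1,\dots,m}\mathbf 1\Big\{\max_{i=1,\dots,m}X_{i+(b-1)m}\le X_{\ell+(b-1)m}\Big\}$$ (maximum and inequality componentwise) be the block estimator. Suppose that $0<p<1$. Then there are an integer $r\in\{1,\dots,k-1\}$ and a constant $c_r\in(0,1-p]$ such that $p_m-p\sim c_r/m^r$ as $m\to\infty$, and such that the following holds. If $m=m(n)$ is any sequence of integers with $n/m(n)\to\infty$ and $m(n)/n^{1/(2r+1)}\to\lambda\in(0,\infty]$ as $n\to\infty$, then $$\sqrt{n/m}\,(\hat p_m-p)\longrightarrow N\Big\{\frac{c_r}{\lambda^{r+1/2}},\,p(1-p)\Big\}\qquad(n\to\infty)$$ in distribution, where $1/\infty$ is read as $0$ and $N\{\mu,\sigma^2\}$ is the normal law with mean $\mu$ and variance $\sigma^2$. -/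

import Mathlib

open MeasureTheory ProbabilityTheory Filter Topology Asymptotics
open scoped ENNReal NNReal

noncomputable section

namespace Concurrence

/-- The number of indices `i` such that the random point `ζ i` falls in `A`. -/
def pointCount {Ω E : Type*} (ζ : ℕ → Ω → E) (A : Set E) (ω : Ω) : ℕ∞ :=
  Set.encard {i : ℕ | ζ i ω ∈ A}

/-- The random points `ζ 0, ζ 1, …` are the points of a Poisson point process on `E` with
intensity measure `ν`: the number of points in a measurable set `A` is Poisson with mean `ν A`
(almost surely infinite if `ν A = ∞`), and the numbers of points in finitely many pairwise
disjoint measurable sets are independent. -/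
structure IsPoissonPointProcess {Ω E : Type*} [MeasurableSpace Ω] [MeasurableSpace E]
    (Q : Measure Ω) (ζ : ℕ → Ω → E) (ν : Measure E) : Prop where
  measurable : ∀ i, Measurable (ζ i)
  hasLaw_count : ∀ A : Set E, MeasurableSet A → ν A ≠ ∞ →
    HasLaw (pointCount ζ A)
      ((poissonMeasure (ν A).toNNReal).map (fun n : ℕ => (n : ℕ∞))) Q
  count_eq_top : ∀ A : Set E, MeasurableSet A → ν A = ∞ →
    ∀ᵐ ω ∂Q, pointCount ζ A ω = ⊤
  indep_count : ∀ (q : ℕ) (A : Fin q → Set E), (∀ a, MeasurableSet (A a)) →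
    Pairwise (fun a b => Disjoint (A a) (A b)) →
    iIndepFun (fun a => pointCount ζ (A a)) Q

/-- The measure `z⁻² dz` on `(0, ∞)`. -/
def spectralIntensity : Measure ℝ :=
  (volume.restrict (Set.Ioi 0)).withDensity (fun z => ENNReal.ofReal ((z ^ 2)⁻¹))

/-- `ζ` and `Y` are the ingredients of the spectral representation
`η(s) = max_i ζ i * Y i s` of a simple max-stable process on `𝒳`: the `ζ i` are the points of a
Poisson process on `(0, ∞)` with intensity `z⁻² dz`; the `Y i` are independent copies, independent
of `ζ`, of a nonnegative process with continuous sample paths on `𝒳`,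
with `E Y(s) = 1` for all `s` and `E sup_s Y(s) < ∞`. -/
structure IsSpectralRepresentation {Ω 𝒳 : Type*} [MeasurableSpace Ω] [TopologicalSpace 𝒳]
    (Q : Measure Ω) (ζ : ℕ → Ω → ℝ) (Y : ℕ → 𝒳 → Ω → ℝ) : Prop where
  zeta_pos : ∀ i ω, 0 < ζ i ω
  zeta_poisson : IsPoissonPointProcess Q ζ spectralIntensity
  measurable : ∀ i s, Measurable (Y i s)
  nonneg : ∀ i s ω, 0 ≤ Y i s ω
  continuous_paths : ∀ i ω, Continuous (fun s => Y i s ω)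
  indep : iIndepFun (fun i ω s => Y i s ω) Q
  identDistrib : ∀ i, IdentDistrib (fun ω s => Y i s ω) (fun ω s => Y 0 s ω) Q Q
  integral_eq_one : ∀ s, ∫ ω, Y 0 s ω ∂Q = 1
  lintegral_sup_lt_top : ∫⁻ ω, ⨆ s, ENNReal.ofReal (Y 0 s ω) ∂Q < ∞
  indep_zeta : IndepFun (fun ω i => ζ i ω) (fun ω i s => Y i s ω) Q

/-- The max-stable process `η(s) = max_i ζ i * Y i s`. -/
def maxStable {Ω 𝒳 : Type*} (ζ : ℕ → Ω → ℝ) (Y : ℕ → 𝒳 → Ω → ℝ) (s : 𝒳) (ω : Ω) : ℝ :=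
  ⨆ i, ζ i ω * Y i s ω

/-- The extremal concurrence probability at the sites `s 0, …, s (k - 1)`: the probability that
one single function `ζ ℓ * Y ℓ` attains the maximum `η` at all of the sites. -/
def extremalProb {Ω 𝒳 : Type*} [MeasurableSpace Ω] (Q : Measure Ω)
    (ζ : ℕ → Ω → ℝ) (Y : ℕ → 𝒳 → Ω → ℝ) {k : ℕ} (s : Fin k → 𝒳) : ℝ :=
  Q.real {ω | ∃ l : ℕ, ∀ j, maxStable ζ Y (s j) ω = ζ l ω * Y l (s j) ω}

/-- Sample concurrence: one of the vectors `x 0, …, x (m - 1)` of `ℝᵏ` dominates the componentwise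
maximum of all of them. -/
def SampleConcurrent {m k : ℕ} (x : Fin m → Fin k → ℝ) : Prop :=
  ∃ l, ∀ i j, x i j ≤ x l j

/-- The sample concurrence probability `p_m` of `X 0, …, X (m - 1)`. -/
def sampleProb {Ω : Type*} [MeasurableSpace Ω] (P : Measure Ω) {k : ℕ}
    (X : ℕ → Ω → Fin k → ℝ) (m : ℕ) : ℝ :=
  P.real {ω | SampleConcurrent (fun (i : Fin m) => X i ω)}

open Classical in
/-- The sample concurrence probability estimator with sample size `n` and block size `m`: the
proportion of the `[n/m]` blocks `x (b * m), …, x (b * m + m - 1)`, `b < [n/m]`, of the data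
in which sample concurrence occurs. -/
def blockEstimator {k : ℕ} (n m : ℕ) (x : ℕ → Fin k → ℝ) : ℝ :=
  (1 / ((n / m : ℕ) : ℝ)) * ∑ b ∈ Finset.range (n / m),
    if SampleConcurrent (fun i : Fin m => x (i + b * m)) then (1 : ℝ) else 0

end Concurrence

end

namespace Concurrence

/-! The theorem rests on an exact formula: the sample concurrence probability is a polynomial in `1
/ m`. Give each point of the Poisson process an independent uniform label in `Fin m`. Points with
different labels form independent Poisson processes whose intensity is divided by `m`. Since `z⁻²
dz` is homogeneous, `m` times the maximum over each class is again a copy of the max-stable vector,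
so the `m` rescaled class maxima may replace the sample (`IsSpectralVector.map_labelledMax`,
obtained from the Laplace functional of a marked Poisson process).

Now fix the points and let only the labels be random. Almost surely each site has exactly one point
attaining its maximum (`IsSpectralVector.ae_unique`). Let `n + 1` be the number of points that
attain the maximum at some site. One class dominates all the others exactly when these points share
a label, which has probability `m * m⁻¹ ^ (n + 1) = m⁻¹ ^ n`. Averaging, `p_m = ∑ n < k, q n / m ^
n` where `q n` is the probability that there are `n + 1` such points
(`IsSpectralVector.sampleProb_eq_sum`). Here `q 0 = p` and the `q n` add up to `1`, so for `p < 1`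
some `q n` with `n ≥ 1` is positive; the least such `n` is `r`, and `c = q r ≤ 1 - p`.

The estimator is a mean of `[n/m]` independent Bernoulli variables with parameter `p_m → p`. Its
bias, multiplied by `√(n/m)`, is asymptotic to `c / (m / n ^ (1 / (2r+1))) ^ (r + 1/2)`
(`tendsto_sqrt_mul_sub`). The limit law follows by expanding characteristic functions to second
order (`tendsto_bernoulli_charFun_pow`). -/

/-- The function `t ↦ exp (-t)` on `[0, ∞]`, with value `0` at `∞`. -/
noncomputable def negExp (t : ℝ≥0∞) : ℝ≥0∞ := EReal.exp (-(t : EReal))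

lemma negExp_add (a b : ℝ≥0∞) : negExp (a + b) = negExp a * negExp b := by
  simp only [negExp, EReal.exp_neg, EReal.coe_ennreal_add, EReal.exp_add]
  refine ENNReal.mul_inv (Or.inl ?_) (Or.inr ?_) <;> simp

@[simp] lemma negExp_zero : negExp 0 = 1 := by simp [negExp]

@[simp] lemma negExp_top : negExp ∞ = 0 := by simp [negExp]

lemma negExp_sum {ι : Type*} (s : Finset ι) (f : ι → ℝ≥0∞) :
    negExp (∑ i ∈ s, f i) = ∏ i ∈ s, negExp (f i) := by
  classical
  induction s using Finset.induction_on with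
  | empty => simp
  | insert i s hi ih => rw [Finset.sum_insert hi, Finset.prod_insert hi, negExp_add, ih]

lemma continuous_negExp : Continuous negExp :=
  ENNReal.continuous_exp.comp (continuous_neg.comp continuous_coe_ennreal_ereal)

lemma antitone_negExp : Antitone negExp := fun a b hab => by
  simpa [negExp] using hab

lemma negExp_ofReal {t : ℝ} (ht : 0 ≤ t) :
    negExp (ENNReal.ofReal t) = ENNReal.ofReal (Real.exp (-t)) := by
  rw [negExp, EReal.coe_ennreal_ofReal, max_eq_left ht, ← EReal.coe_neg, EReal.exp_coe]

/-! ### Moments of the Poisson distribution. -/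

lemma lintegral_poissonMeasure (r : ℝ≥0) (f : ℕ → ℝ≥0∞) :
    ∫⁻ n, f n ∂(poissonMeasure r) =
      ∑' n : ℕ, ENNReal.ofReal (Real.exp (-r) * r ^ n / n.factorial) * f n := by
  rw [poissonMeasure, lintegral_sum_measure]
  simp

/-- The probability generating function of the Poisson distribution. -/
lemma lintegral_pow_poissonMeasure (r : ℝ≥0) {c : ℝ≥0∞} (hc : c ≤ 1) :
    ∫⁻ n, c ^ n ∂(poissonMeasure r) = negExp ((1 - c) * r) := by
  lift c to ℝ≥0 using (hc.trans_lt ENNReal.one_lt_top).ne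
  have hc' : c ≤ 1 := by exact_mod_cast hc
  have h1 : ((1 - (c : ℝ≥0∞)) * r) = ENNReal.ofReal ((1 - c) * r) := by
    rw [ENNReal.ofReal_mul (by simpa using hc'), ENNReal.ofReal_sub _ c.coe_nonneg]
    simp
  rw [lintegral_poissonMeasure, h1,
    negExp_ofReal (mul_nonneg (by simpa using hc') r.coe_nonneg)]
  have h2 : ∀ n : ℕ, ENNReal.ofReal (Real.exp (-r) * r ^ n / n.factorial) * (c : ℝ≥0∞) ^ n =
      ENNReal.ofReal (Real.exp (-r) * ((r * c : ℝ) ^ n / n.factorial)) := by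
    intro n
    rw [← ENNReal.coe_pow, ← ENNReal.ofReal_coe_nnreal (p := c ^ n),
      ← ENNReal.ofReal_mul (by positivity)]
    congr 1
    push_cast
    ring
  simp_rw [h2]
  have h3 : HasSum (fun n : ℕ => Real.exp (-r) * ((r * c : ℝ) ^ n / n.factorial))
      (Real.exp (-r) * Real.exp (r * c)) := by
    refine HasSum.mul_left _ ?_
    rw [Real.exp_eq_exp_ℝ]
    exact NormedSpace.expSeries_div_hasSum_exp (r * c : ℝ)
  rw [← ENNReal.ofReal_tsum_of_nonneg (fun n => by positivity) h3.summable, h3.tsum_eq,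
    ← Real.exp_add]
  congr 2
  ring

/-- The mean of the Poisson distribution. -/
lemma lintegral_natCast_poissonMeasure (r : ℝ≥0) :
    ∫⁻ n, (n : ℝ≥0∞) ∂(poissonMeasure r) = r := by
  have h1 : ∑' n : ℕ, ENNReal.ofReal (Real.exp (-r) * r ^ n / n.factorial) = 1 := by
    rw [← ENNReal.ofReal_tsum_of_nonneg (fun n => by positivity)
      (hasSum_one_poissonMeasure r).summable, (hasSum_one_poissonMeasure r).tsum_eq]
    simp
  rw [lintegral_poissonMeasure, tsum_eq_zero_add' ENNReal.summable]
  have h2 : ∀ n : ℕ, ENNReal.ofReal (Real.exp (-r) * r ^ (n + 1) / (n + 1).factorial) *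
      ((n + 1 : ℕ) : ℝ≥0∞) = r * ENNReal.ofReal (Real.exp (-r) * r ^ n / n.factorial) := by
    intro n
    rw [← ENNReal.ofReal_natCast (n + 1), ← ENNReal.ofReal_coe_nnreal (p := r),
      ← ENNReal.ofReal_mul (by positivity), ← ENNReal.ofReal_mul (by positivity)]
    congr 1
    rw [Nat.factorial_succ]
    push_cast
    field_simp
    ring
  simp_rw [h2, ENNReal.tsum_mul_left, h1]
  simp

/-! ### Laplace functionals of Poisson processes. -/

section PoissonProcess

variable {Ω E : Type*}

lemma pointCount_eq_tsum (ζ : ℕ → Ω → E) (A : Set E) (ω : Ω) :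
    ((pointCount ζ A ω : ℕ∞) : ℝ≥0∞) = ∑' i, A.indicator 1 (ζ i ω) := by
  rw [pointCount, ← ENNReal.tsum_set_one,
    tsum_subtype {i : ℕ | ζ i ω ∈ A} (fun _ => (1 : ℝ≥0∞))]
  rfl

/-- The product, over a sequence of points, of a function taking the value `1 - c a` on the
disjoint sets `A a`, each containing finitely many of the points, and `1` elsewhere. -/
lemma iInf_prod_eq_prod_pow {ι : Type*} [Fintype ι] {A : ι → Set E}
    (hd : Pairwise (fun a b => Disjoint (A a) (A b))) {c : ι → ℝ≥0∞} (z : ℕ → E)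
    (hfin : ∀ a, {i | z i ∈ A a}.Finite) :
    ⨅ M, ∏ i ∈ Finset.range M, (1 - ∑ a, (A a).indicator (fun _ => c a) (z i)) =
      ∏ a, (1 - c a) ^ {i | z i ∈ A a}.ncard := by
  classical
  -- By disjointness at most one summand is nonzero at `x`, so the difference factors.
  have h1 : ∀ x, 1 - ∑ a, (A a).indicator (fun _ => c a) x =
      ∏ a, if x ∈ A a then 1 - c a else 1 := by
    intro x
    by_cases hx : ∃ a, x ∈ A a
    · obtain ⟨a, ha⟩ := hx
      have hb : ∀ b, b ≠ a → x ∉ A b := fun b hb hxb => (hd hb).le_bot ⟨hxb, ha⟩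
      rw [Finset.prod_eq_single a (fun b _ hba => by simp [hb b hba]) (by simp),
        Finset.sum_eq_single a (fun b _ hba => by simp [hb b hba]) (by simp)]
      simp [ha]
    · push Not at hx
      simp [hx]
  have h2 : ∀ M, ∏ i ∈ Finset.range M, (1 - ∑ a, (A a).indicator (fun _ => c a) (z i)) =
      ∏ a, (1 - c a) ^ ((Finset.range M).filter (fun i => z i ∈ A a)).card := by
    intro M
    simp_rw [h1]
    rw [Finset.prod_comm]
    refine Finset.prod_congr rfl fun a _ => ?_
    rw [← Finset.prod_filter, Finset.prod_const]
  simp_rw [h2]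
  have hle : ∀ a, 1 - c a ≤ 1 := fun a => tsub_le_self
  refine le_antisymm ?_ (le_iInf fun M => Finset.prod_le_prod' fun a _ => ?_)
  -- Past the last index that hits any `A a`, the partial product has reached its final value.
  · have hfin' : (⋃ a, {i | z i ∈ A a}).Finite := Set.finite_iUnion hfin
    obtain ⟨M, hM⟩ := hfin'.bddAbove
    refine (iInf_le _ (M + 1)).trans (le_of_eq (Finset.prod_congr rfl fun a _ => ?_))
    congr 1
    rw [← Set.ncard_coe_finset]
    congr 1
    ext i
    simp only [Finset.coe_filter, Finset.mem_range, Set.mem_ofPred_eq, and_iff_right_iff_imp]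
    intro hi
    exact Nat.lt_succ_of_le (hM (Set.mem_iUnion.2 ⟨a, hi⟩))
  · refine pow_le_pow_right_of_le_one' (hle a) ?_
    rw [← Set.ncard_coe_finset]
    exact Set.ncard_le_ncard (fun i hi => by simpa using (Finset.mem_filter.1 hi).2) (hfin a)

variable [MeasurableSpace Ω] [MeasurableSpace E]

/-- Campbell's formula: the laws of the points of a Poisson process add up to its intensity. -/
lemma IsPoissonPointProcess.sum_map {Q : Measure Ω} {ζ : ℕ → Ω → E} {ν : Measure E}
    (h : IsPoissonPointProcess Q ζ ν) [IsProbabilityMeasure Q] :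
    Measure.sum (fun i => Q.map (ζ i)) = ν := by
  ext A hA
  have h1 : Measure.sum (fun i => Q.map (ζ i)) A =
      ∫⁻ ω, ((pointCount ζ A ω : ℕ∞) : ℝ≥0∞) ∂Q := by
    simp_rw [pointCount_eq_tsum]
    rw [lintegral_tsum
      (fun i => (show Measurable (fun ω => A.indicator (1 : E → ℝ≥0∞) (ζ i ω)) from
        (measurable_one.indicator hA).comp (h.measurable i)).aemeasurable),
      Measure.sum_apply _ hA]
    congr with i
    rw [Measure.map_apply (h.measurable i) hA]
    exact (lintegral_indicator_one (h.measurable i hA)).symm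
  rw [h1]
  by_cases hν : ν A = ∞
  · rw [lintegral_congr_ae (g := fun _ => ∞)
      ((h.count_eq_top A hA hν).mono fun ω hω => by simp [hω])]
    simp [hν]
  · have hl := h.hasLaw_count A hA hν
    rw [← lintegral_map' (f := fun n : ℕ∞ => (n : ℝ≥0∞)) (Measurable.of_discrete).aemeasurable
      hl.aemeasurable, hl.map_eq, lintegral_map Measurable.of_discrete Measurable.of_discrete]
    simp only [ENat.toENNReal_coe]
    rw [lintegral_natCast_poissonMeasure, ENNReal.coe_toNNReal hν]

variable {Q : Measure Ω} {ζ : ℕ → Ω → E} {ν : Measure E}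

/-- The law of the count is the image of a law on `ℕ`, so it does not charge `⊤`. -/
lemma IsPoissonPointProcess.ae_finite (h : IsPoissonPointProcess Q ζ ν) {A : Set E}
    (hA : MeasurableSet A) (hν : ν A ≠ ∞) : ∀ᵐ ω ∂Q, {i | ζ i ω ∈ A}.Finite := by
  have hl := h.hasLaw_count A hA hν
  have h1 : ∀ᵐ n ∂(Q.map (pointCount ζ A)), n ≠ ⊤ := by
    rw [hl.map_eq, ae_map_iff Measurable.of_discrete.aemeasurable MeasurableSet.of_discrete]
    exact Eventually.of_forall fun n => ENat.natCast_ne_top n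
  filter_upwards [ae_of_ae_map hl.aemeasurable h1] with ω hω
  exact Set.encard_ne_top_iff.1 hω

lemma IsPoissonPointProcess.lintegral_pow (h : IsPoissonPointProcess Q ζ ν) {A : Set E}
    (hA : MeasurableSet A) (hν : ν A ≠ ∞) {c : ℝ≥0∞} (hc : c ≤ 1) :
    ∫⁻ ω, (1 - c) ^ {i | ζ i ω ∈ A}.ncard ∂Q = negExp (c * ν A) := by
  have hl := h.hasLaw_count A hA hν
  have h1 : ∫⁻ ω, (1 - c) ^ {i | ζ i ω ∈ A}.ncard ∂Q =
      ∫⁻ n : ℕ∞, (1 - c) ^ n.toNat ∂(Q.map (pointCount ζ A)) := by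
    rw [lintegral_map' Measurable.of_discrete.aemeasurable hl.aemeasurable]
    rfl
  rw [h1, hl.map_eq, lintegral_map Measurable.of_discrete Measurable.of_discrete]
  simp only [ENat.toNat_natCast]
  rw [lintegral_pow_poissonMeasure _ tsub_le_self, ENNReal.coe_toNNReal hν,
    ENNReal.sub_sub_cancel ENNReal.one_ne_top hc]

lemma IsPoissonPointProcess.lintegral_prod_sum_indicator (h : IsPoissonPointProcess Q ζ ν)
    {q : ℕ} {A : Fin q → Set E} (hA : ∀ a, MeasurableSet (A a))
    (hd : Pairwise (fun a b => Disjoint (A a) (A b))) (hν : ∀ a, ν (A a) ≠ ∞)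
    {c : Fin q → ℝ≥0∞} (hc : ∀ a, c a ≤ 1) :
    ∫⁻ ω, ⨅ M, ∏ i ∈ Finset.range M, (1 - ∑ a, (A a).indicator (fun _ => c a) (ζ i ω)) ∂Q =
      negExp (∑ a, c a * ν (A a)) := by
  have h1 : ∀ᵐ ω ∂Q, ∀ a, {i | ζ i ω ∈ A a}.Finite :=
    ae_all_iff.2 fun a => h.ae_finite (hA a) (hν a)
  rw [lintegral_congr_ae (h1.mono fun ω hω => iInf_prod_eq_prod_pow hd _ hω), negExp_sum]
  have hind : iIndepFun (fun a ω => (1 - c a) ^ {i | ζ i ω ∈ A a}.ncard) Q :=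
    (h.indep_count q A hA hd).comp (fun a (n : ℕ∞) => (1 - c a) ^ n.toNat)
      (fun a => Measurable.of_discrete)
  have hm : ∀ a, Measurable (fun ω => (1 - c a) ^ {i | ζ i ω ∈ A a}.ncard) := by
    intro a
    have h2 : Measurable (fun ω => ((pointCount ζ (A a) ω : ℕ∞) : ℝ≥0∞)) := by
      simp_rw [pointCount_eq_tsum]
      exact Measurable.tsum fun i =>
        (measurable_one.indicator (hA a)).comp (h.measurable i)
    have h3 : Measurable (fun ω => (1 - c a) ^
        ⌊((pointCount ζ (A a) ω : ℕ∞) : ℝ≥0∞).toReal⌋₊) :=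
      (Measurable.of_discrete (f := fun n : ℕ => (1 - c a) ^ n)).comp
        (Nat.measurable_floor.comp h2.ennreal_toReal)
    -- The cardinality is recovered from the measurable `ℝ≥0∞`-valued count; at `⊤` both sides take
    -- the default value `0`.
    have h4 : ∀ n : ℕ∞, ⌊(n : ℝ≥0∞).toReal⌋₊ = n.toNat := fun n => by
      cases n <;> simp
    simp_rw [h4] at h3
    exact h3
  rw [lintegral_prod_eq_prod_lintegral_of_indepFun _ _ hind hm]
  exact Finset.prod_congr rfl fun a _ => h.lintegral_pow (hA a) (hν a) (hc a)

/-- The Laplace functional of a Poisson process, for a simple function. -/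
lemma IsPoissonPointProcess.lintegral_prod_simpleFunc (h : IsPoissonPointProcess Q ζ ν)
    (f : SimpleFunc E ℝ≥0∞) (hf : ∀ x, f x ≤ 1) (hν : ν {x | f x ≠ 0} ≠ ∞) :
    ∫⁻ ω, ⨅ M, ∏ i ∈ Finset.range M, (1 - f (ζ i ω)) ∂Q = negExp (∫⁻ x, f x ∂ν) := by
  classical
  -- The level sets of the nonzero values of `f` are the disjoint sets on which the counts are
  -- independent.
  let e := (f.range.erase 0).equivFin.symm
  let c : Fin (f.range.erase 0).card → ℝ≥0∞ := fun a => (e a : ℝ≥0∞)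
  let A : Fin (f.range.erase 0).card → Set E := fun a => f ⁻¹' {c a}
  have hc0 : ∀ a, c a ≠ 0 := fun a => (Finset.mem_erase.1 (e a).2).1
  have hA : ∀ a, MeasurableSet (A a) := fun a => f.measurableSet_fiber _
  have hd : Pairwise (fun a b => Disjoint (A a) (A b)) := by
    intro a b hab
    refine Set.disjoint_left.2 fun x hx hx' => hab (e.injective (Subtype.ext ?_))
    exact (show f x = c a from hx).symm.trans hx'
  have hνA : ∀ a, ν (A a) ≠ ∞ := fun a =>
    measure_ne_top_of_subset (fun x hx => by
      rw [Set.mem_ofPred_eq, show f x = c a from hx]; exact hc0 a) hν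
  have hsum : ∀ x, f x = ∑ a, (A a).indicator (fun _ => c a) x := by
    intro x
    by_cases hx : f x = 0
    · rw [hx, Finset.sum_eq_zero]
      intro a _
      refine Set.indicator_of_notMem (fun hxa => hc0 a ?_) _
      exact (show f x = c a from hxa).symm.trans hx
    · let a := e.symm ⟨f x, Finset.mem_erase.2 ⟨hx, f.mem_range_self x⟩⟩
      have ha : c a = f x := by simp [c, a]
      rw [Finset.sum_eq_single a, Set.indicator_of_mem (show x ∈ A a from ha.symm), ha]
      · intro b _ hba
        refine Set.indicator_of_notMem (fun hxb => ?_) _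
        exact (hd hba).le_bot ⟨hxb, show x ∈ A a from ha.symm⟩
      · simp
  have hc : ∀ a, c a ≤ 1 := by
    intro a
    obtain ⟨x, hx⟩ := f.mem_range.1 (Finset.mem_erase.1 (e a).2).2
    rw [show c a = f x from hx.symm]
    exact hf x
  simp_rw [hsum]
  rw [h.lintegral_prod_sum_indicator hA hd hνA hc,
    lintegral_finsetSum _ (fun a _ => measurable_const.indicator (hA a))]
  simp_rw [lintegral_indicator_const (hA _)]

/-- The Laplace functional of a Poisson process. -/
lemma IsPoissonPointProcess.lintegral_iInf_prod [SigmaFinite ν] [IsProbabilityMeasure Q]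
    (h : IsPoissonPointProcess Q ζ ν) {u : E → ℝ≥0∞} (hu : Measurable u) (hu1 : ∀ x, u x ≤ 1) :
    ∫⁻ ω, ⨅ M, ∏ i ∈ Finset.range M, (1 - u (ζ i ω)) ∂Q = negExp (∫⁻ x, u x ∂ν) := by
  -- The restriction to spanning sets makes each approximant vanish outside a set of finite measure.
  let f : ℕ → SimpleFunc E ℝ≥0∞ := fun n =>
    (SimpleFunc.eapprox u n).restrict (spanningSets ν n)
  have hfx : ∀ n x, f n x = (spanningSets ν n).indicator (SimpleFunc.eapprox u n) x := fun n x =>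
    SimpleFunc.restrict_apply _ (measurableSet_spanningSets ν n) x
  have hle : ∀ n x, SimpleFunc.eapprox u n x ≤ u x := fun n x => by
    rw [← SimpleFunc.iSup_eapprox_apply hu x]
    exact le_iSup (fun n => SimpleFunc.eapprox u n x) n
  have hfu : ∀ n x, f n x ≤ u x := fun n x => by
    rw [hfx]
    exact (Set.indicator_le_self _ _ x).trans (hle n x)
  have hmono : ∀ x, Monotone (fun n => f n x) := by
    intro x n n' hn
    simp only [hfx]
    refine (Set.indicator_le_indicator_of_subset (monotone_spanningSets ν hn)
      (fun _ => zero_le) x).trans (Set.indicator_le_indicator ?_)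
    exact SimpleFunc.monotone_eapprox u hn x
  have htend : ∀ x, Tendsto (fun n => f n x) atTop (𝓝 (u x)) := by
    intro x
    refine (SimpleFunc.tendsto_eapprox hu x).congr' ?_
    obtain ⟨N, hN⟩ := Set.mem_iUnion.1 ((iUnion_spanningSets ν).symm ▸ Set.mem_univ x)
    filter_upwards [eventually_ge_atTop N] with n hn
    rw [hfx, Set.indicator_of_mem (monotone_spanningSets ν hn hN)]
  have hlap : ∀ n, ∫⁻ ω, ⨅ M, ∏ i ∈ Finset.range M, (1 - f n (ζ i ω)) ∂Q =
      negExp (∫⁻ x, f n x ∂ν) := fun n => by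
    refine h.lintegral_prod_simpleFunc (f n) (fun x => (hfu n x).trans (hu1 x)) ?_
    refine measure_ne_top_of_subset (fun x hx => ?_) (measure_spanningSets_lt_top ν n).ne
    by_contra hx'
    exact hx (by rw [hfx, Set.indicator_of_notMem hx'])
  have hmeas : ∀ {v : E → ℝ≥0∞}, Measurable v → ∀ i, Measurable (fun ω => 1 - v (ζ i ω)) :=
    fun hv i => measurable_const.sub (hv.comp (h.measurable i))
  have hlim1 : Tendsto (fun n => negExp (∫⁻ x, f n x ∂ν)) atTop (𝓝 (negExp (∫⁻ x, u x ∂ν))) :=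
    (continuous_negExp.tendsto _).comp (lintegral_tendsto_of_tendsto_of_monotone
      (fun n => (f n).measurable.aemeasurable) (ae_of_all _ hmono) (ae_of_all _ htend))
  have hG : ∀ ω, ⨅ n, ⨅ M, ∏ i ∈ Finset.range M, (1 - f n (ζ i ω)) =
      ⨅ M, ∏ i ∈ Finset.range M, (1 - u (ζ i ω)) := by
    intro ω
    rw [iInf_comm]
    congr with M
    refine tendsto_nhds_unique (tendsto_atTop_iInf fun n n' hn =>
      Finset.prod_le_prod' fun i _ => tsub_le_tsub_left (hmono _ hn) _) ?_
    refine ENNReal.tendsto_finsetProd_of_ne_top _ (fun i _ => ?_) (fun i _ => ?_)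
    · exact ENNReal.Tendsto.sub tendsto_const_nhds (htend _) (Or.inl ENNReal.one_ne_top)
    · exact (tsub_le_self.trans_lt ENNReal.one_lt_top).ne
  have hlim2 : Tendsto (fun n => ∫⁻ ω, ⨅ M, ∏ i ∈ Finset.range M, (1 - f n (ζ i ω)) ∂Q) atTop
      (𝓝 (∫⁻ ω, ⨅ M, ∏ i ∈ Finset.range M, (1 - u (ζ i ω)) ∂Q)) := by
    have hanti : Antitone (fun n ω => ⨅ M, ∏ i ∈ Finset.range M, (1 - f n (ζ i ω))) :=
      fun n n' hn ω => iInf_mono fun M =>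
        Finset.prod_le_prod' fun i _ => tsub_le_tsub_left (hmono _ hn) _
    simp_rw [← hG]
    rw [lintegral_iInf (fun n => Measurable.iInf fun M => Finset.measurable_prod _ fun i _ =>
      hmeas (f n).measurable i) hanti]
    · exact tendsto_atTop_iInf fun n n' hn => lintegral_mono (hanti hn)
    · rw [hlap 0]
      exact ((antitone_negExp zero_le).trans_lt (by simp)).ne
  simp_rw [hlap] at hlim2
  exact tendsto_nhds_unique hlim2 hlim1

/-- The Laplace functional of an independently marked Poisson process. -/
lemma IsPoissonPointProcess.iInf_lintegral_prod_marked [SigmaFinite ν] [IsProbabilityMeasure Q]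
    (h : IsPoissonPointProcess Q ζ ν) {F : Type*} [MeasurableSpace F] {W : ℕ → Ω → F}
    {ρ : Measure F} [IsProbabilityMeasure ρ]
    (hW : ∀ i, Measurable (W i)) (hWi : iIndepFun W Q) (hWρ : ∀ i, Q.map (W i) = ρ)
    (hζW : IndepFun (fun ω i => ζ i ω) (fun ω i => W i ω) Q)
    {φ : E × F → ℝ≥0∞} (hφ : Measurable φ) (hφ1 : ∀ x, φ x ≤ 1) :
    ⨅ M, ∫⁻ ω, ∏ i ∈ Finset.range M, φ (ζ i ω, W i ω) ∂Q =
      negExp (∫⁻ z, ∫⁻ w, 1 - φ (z, w) ∂ρ ∂ν) := by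
  have hζm : Measurable (fun ω i => ζ i ω) := measurable_pi_lambda _ h.measurable
  have hWm : Measurable (fun ω i => W i ω) := measurable_pi_lambda _ hW
  have hgm : Measurable (fun z => ∫⁻ w, φ (z, w) ∂ρ) := hφ.lintegral_prod_right'
  have hum : Measurable (fun z => ∫⁻ w, 1 - φ (z, w) ∂ρ) :=
    (measurable_const.sub hφ).lintegral_prod_right'
  have hg1 : ∀ z, ∫⁻ w, φ (z, w) ∂ρ ≤ 1 := fun z =>
    (lintegral_mono fun w => hφ1 (z, w)).trans (by simp)
  have hgu : ∀ z, 1 - ∫⁻ w, 1 - φ (z, w) ∂ρ = ∫⁻ w, φ (z, w) ∂ρ := by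
    intro z
    rw [lintegral_sub (show Measurable (fun w => φ (z, w)) from hφ.comp measurable_prodMk_left)
      ((hg1 z).trans_lt ENNReal.one_lt_top).ne (ae_of_all _ fun w => hφ1 (z, w))]
    simp only [lintegral_const, measure_univ, mul_one]
    exact ENNReal.sub_sub_cancel ENNReal.one_ne_top (hg1 z)
  -- Given the points, the marks are independent with law `ρ`, so each factor can be replaced by its
  -- mean over the mark.
  have hprod : ∀ M, ∫⁻ ω, ∏ i ∈ Finset.range M, φ (ζ i ω, W i ω) ∂Q =
      ∫⁻ ω, ∏ i ∈ Finset.range M, (1 - ∫⁻ w, 1 - φ (ζ i ω, w) ∂ρ) ∂Q := by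
    intro M
    simp_rw [hgu]
    have hm : Measurable (fun x : (ℕ → E) × (ℕ → F) =>
        ∏ i ∈ Finset.range M, φ (x.1 i, x.2 i)) := by fun_prop
    have hm' : Measurable (fun z : ℕ → E =>
        ∏ i ∈ Finset.range M, ∫⁻ w, φ (z i, w) ∂ρ) :=
      Finset.measurable_prod _ fun i _ => hgm.comp (measurable_pi_apply i)
    have := (indepFun_iff_map_prod_eq_prod_map_map hζm.aemeasurable hWm.aemeasurable).1 hζW
    rw [← lintegral_map (f := fun x : (ℕ → E) × (ℕ → F) =>
      ∏ i ∈ Finset.range M, φ (x.1 i, x.2 i)) hm (hζm.prodMk hWm), this,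
      lintegral_prod _ hm.aemeasurable, ← lintegral_map hm' hζm]
    refine lintegral_congr fun z => ?_
    rw [lintegral_map (by fun_prop) hWm, lintegral_prod_eq_prod_lintegral_of_indepFun _
      (fun i ω => φ (z i, W i ω)) (hWi.comp (fun i w => φ (z i, w))
        (fun i => hφ.comp measurable_prodMk_left)) (fun i => by fun_prop)]
    refine Finset.prod_congr rfl fun i _ => ?_
    rw [← hWρ i, lintegral_map (show Measurable (fun w => φ (z i, w)) from
      hφ.comp measurable_prodMk_left) (hW i)]
  have hmu : ∀ M, Measurable (fun ω => ∏ i ∈ Finset.range M,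
      (1 - ∫⁻ w, 1 - φ (ζ i ω, w) ∂ρ)) := fun M =>
    Finset.measurable_prod _ fun i _ => measurable_const.sub (hum.comp (h.measurable i))
  simp_rw [hprod]
  rw [← h.lintegral_iInf_prod hum (fun z => (lintegral_mono fun w => tsub_le_self).trans (by simp)),
    lintegral_iInf hmu]
  · intro M M' hM ω
    exact Finset.prod_le_prod_of_subset_of_le_one' (Finset.range_mono hM)
      fun i _ _ => tsub_le_self
  · simp

end PoissonProcess

/-! ### The intensity `z⁻² dz`. -/

instance : SigmaFinite spectralIntensity := by
  unfold spectralIntensity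
  exact SigmaFinite.withDensity_of_ne_top (ae_of_all _ fun _ => ENNReal.ofReal_ne_top)

lemma lintegral_spectralIntensity {G : ℝ → ℝ≥0∞} (hG : Measurable G) :
    ∫⁻ z, G z ∂spectralIntensity =
      ∫⁻ z, (Set.Ioi 0).indicator (fun z => ENNReal.ofReal ((z ^ 2)⁻¹) * G z) z := by
  rw [spectralIntensity, lintegral_withDensity_eq_lintegral_mul _ (by fun_prop) hG,
    ← lintegral_indicator measurableSet_Ioi]
  rfl

/-- Change of variables in `z⁻² dz`. This homogeneity is the source of max-stability. -/
lemma lintegral_spectralIntensity_mul {G : ℝ → ℝ≥0∞} (hG : Measurable G) {c : ℝ} (hc : 0 < c) :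
    ∫⁻ z, G (c * z) ∂spectralIntensity = ENNReal.ofReal c * ∫⁻ z, G z ∂spectralIntensity := by
  have hm : Measurable (fun z : ℝ => (Set.Ioi (0 : ℝ)).indicator
      (fun z => ENNReal.ofReal ((z ^ 2)⁻¹) * G z) z) :=
    Measurable.indicator (by fun_prop) measurableSet_Ioi
  rw [lintegral_spectralIntensity (G := fun z => G (c * z)) (hG.comp (measurable_const_mul c)),
    lintegral_spectralIntensity hG]
  conv_rhs => rw [← Real.smul_map_volume_mul_left hc.ne']
  rw [lintegral_smul_measure, lintegral_map hm (measurable_const_mul c), smul_eq_mul, ← mul_assoc,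
    ← lintegral_const_mul' _ _ (ENNReal.mul_ne_top ENNReal.ofReal_ne_top ENNReal.ofReal_ne_top)]
  refine lintegral_congr fun z => ?_
  by_cases hz : 0 < z
  · rw [Set.indicator_of_mem (Set.mem_Ioi.2 hz), Set.indicator_of_mem
      (Set.mem_Ioi.2 (mul_pos hc hz)), ← mul_assoc, abs_of_pos hc, ← ENNReal.ofReal_mul hc.le,
      ← ENNReal.ofReal_mul (by positivity)]
    congr 2
    field_simp
  · rw [Set.indicator_of_notMem (by simpa using hz), Set.indicator_of_notMem, mul_zero]
    simp only [Set.mem_Ioi, not_lt] at hz ⊢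
    exact mul_nonpos_of_nonneg_of_nonpos hc.le hz

lemma spectralIntensity_Ioi {t : ℝ} (ht : 0 < t) :
    spectralIntensity (Set.Ioi t) = ENNReal.ofReal t⁻¹ := by
  have h1 : ∀ z ∈ Set.Ioi t, (z ^ 2)⁻¹ = z ^ (-2 : ℝ) := by
    intro z hz
    rw [Real.rpow_neg (ht.trans hz).le]
    norm_num
  have h2 : IntegrableOn (fun z : ℝ => z ^ (-2 : ℝ)) (Set.Ioi t) :=
    integrableOn_Ioi_rpow_of_lt (by norm_num) ht
  rw [spectralIntensity, withDensity_apply _ measurableSet_Ioi,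
    Measure.restrict_restrict measurableSet_Ioi, Set.Ioi_inter_Ioi, max_eq_left ht.le,
    setLIntegral_congr_fun measurableSet_Ioi (fun z hz => by rw [h1 z hz]),
    ← ofReal_integral_eq_lintegral_ofReal h2 ((ae_restrict_mem measurableSet_Ioi).mono
      fun z hz => Real.rpow_nonneg (ht.trans hz).le _),
    integral_Ioi_rpow_of_lt (by norm_num) ht]
  norm_num [Real.rpow_neg ht.le]

lemma spectralIntensity_setOf_lt_mul {t w : ℝ} (ht : 0 < t) (hw : 0 ≤ w) :
    spectralIntensity {z | t < z * w} = ENNReal.ofReal t⁻¹ * ENNReal.ofReal w := by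
  rcases hw.eq_or_lt with rfl | hw
  · simp [ht.le.not_gt]
  · have : {z | t < z * w} = Set.Ioi (t / w) := by
      ext z
      simp [div_lt_iff₀ hw]
    rw [this, spectralIntensity_Ioi (div_pos ht hw), ← ENNReal.ofReal_mul (by positivity)]
    congr 1
    field_simp

/-! ### Suprema that are attained. -/

section Attained

variable {a : ℕ → ℝ}

lemma bddAbove_of_finite_setOf_lt (ha : ∀ ε > 0, {i | ε < a i}.Finite) :
    BddAbove (Set.range a) := by
  obtain ⟨B, hB⟩ := ((ha 1 one_pos).image a).bddAbove
  refine ⟨max 1 B, ?_⟩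
  rintro _ ⟨i, rfl⟩
  by_cases hi : 1 < a i
  · exact (hB ⟨i, hi, rfl⟩).trans (le_max_right _ _)
  · exact (not_lt.1 hi).trans (le_max_left _ _)

/-- Only finitely many terms exceed half the supremum, and at least one does; the largest of these
is the supremum. -/
lemma exists_eq_ciSup_of_finite_setOf_lt (ha : ∀ ε > 0, {i | ε < a i}.Finite)
    (hpos : 0 < ⨆ i, a i) : ∃ i, a i = ⨆ i, a i := by
  have hb := bddAbove_of_finite_setOf_lt ha
  obtain ⟨i₀, hi₀⟩ := exists_lt_of_lt_ciSup (half_lt_self hpos)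
  obtain ⟨i, hi, hmax⟩ := Set.exists_max_image _ a (ha _ (half_pos hpos)) ⟨i₀, hi₀⟩
  refine ⟨i, le_antisymm (le_ciSup hb i) (ciSup_le fun l => ?_)⟩
  by_cases hl : (⨆ i, a i) / 2 < a l
  · exact hmax l hl
  · exact (not_lt.1 hl).trans (le_of_lt hi)

end Attained

/-! ### The process at finitely many sites and its exponent measure. -/

/-- The ingredients of the spectral representation, with the spectral functions observed at
finitely many sites only. -/
structure IsSpectralVector {Ω : Type*} [MeasurableSpace Ω] {k : ℕ}
    (Q : Measure Ω) (ζ : ℕ → Ω → ℝ) (W : ℕ → Ω → Fin k → ℝ) : Prop where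
  zeta_pos : ∀ i ω, 0 < ζ i ω
  zeta_poisson : IsPoissonPointProcess Q ζ spectralIntensity
  measurable : ∀ i, Measurable (W i)
  nonneg : ∀ i ω j, 0 ≤ W i ω j
  indep : iIndepFun W Q
  map_eq : ∀ i, Q.map (W i) = Q.map (W 0)
  lintegral_eq_one : ∀ j, ∫⁻ ω, ENNReal.ofReal (W 0 ω j) ∂Q = 1
  indep_zeta : IndepFun (fun ω i => ζ i ω) (fun ω i => W i ω) Q

lemma IsSpectralRepresentation.isSpectralVector {Ω 𝒳 : Type*} [MeasurableSpace Ω]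
    [TopologicalSpace 𝒳] {Q : Measure Ω} {ζ : ℕ → Ω → ℝ} {Y : ℕ → 𝒳 → Ω → ℝ}
    (h : IsSpectralRepresentation Q ζ Y) {k : ℕ} (s : Fin k → 𝒳) :
    IsSpectralVector Q ζ (fun i ω j => Y i (s j) ω) where
  zeta_pos := h.zeta_pos
  zeta_poisson := h.zeta_poisson
  measurable i := measurable_pi_lambda _ fun j => h.measurable i (s j)
  nonneg i ω j := h.nonneg i (s j) ω
  indep := h.indep.comp (fun _ y j => y (s j)) (fun _ => by fun_prop)
  map_eq i := ((h.identDistrib i).comp (u := fun (y : 𝒳 → ℝ) (j : Fin k) => y (s j))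
    (measurable_pi_lambda _ fun j => measurable_pi_apply (s j))).map_eq
  lintegral_eq_one j := by
    -- A non-integrable function has integral `0` by convention, so integral `1` forces
    -- integrability.
    have hi : Integrable (Y 0 (s j)) Q := by
      by_contra hn
      have := h.integral_eq_one (s j)
      rw [integral_undef hn] at this
      exact zero_ne_one this
    rw [← ofReal_integral_eq_lintegral_ofReal hi (ae_of_all _ (h.nonneg 0 (s j))),
      h.integral_eq_one]
    simp
  indep_zeta := h.indep_zeta.comp (φ := id)
    (ψ := fun (y : ℕ → 𝒳 → ℝ) (i : ℕ) (j : Fin k) => y i (s j)) measurable_id (by fun_prop)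

section SpectralVector

variable {Ω : Type*} [MeasurableSpace Ω] {k : ℕ} {Q : Measure Ω}
  {ζ : ℕ → Ω → ℝ} {W : ℕ → Ω → Fin k → ℝ}

/-- The mean number of the points `ζ i • W i` outside the set `B`. -/
noncomputable def exponentMeasure (Q : Measure Ω) (W : ℕ → Ω → Fin k → ℝ)
    (B : Set (Fin k → ℝ)) : ℝ≥0∞ :=
  ∫⁻ z, ∫⁻ w, 1 - B.indicator 1 (z • w) ∂(Q.map (W 0)) ∂spectralIntensity

lemma measurable_one_sub_indicator_smul {B : Set (Fin k → ℝ)} (hB : MeasurableSet B) :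
    Measurable (fun x : ℝ × (Fin k → ℝ) =>
      1 - B.indicator (1 : (Fin k → ℝ) → ℝ≥0∞) (x.1 • x.2)) :=
  measurable_const.sub ((measurable_one.indicator hB).comp (measurable_fst.smul measurable_snd))

lemma IsSpectralVector.measurable_mul (h : IsSpectralVector Q ζ W) (i : ℕ) (j : Fin k) :
    Measurable (fun ω => ζ i ω * W i ω j) :=
  (h.zeta_poisson.measurable i).mul ((measurable_pi_apply j).comp (h.measurable i))

variable [IsProbabilityMeasure Q]

lemma exponentMeasure_smul {B : Set (Fin k → ℝ)} (hB : MeasurableSet B) {c : ℝ} (hc : 0 < c) :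
    exponentMeasure Q W {v | c • v ∈ B} = ENNReal.ofReal c * exponentMeasure Q W B := by
  have hm := measurable_one_sub_indicator_smul hB
  rw [exponentMeasure, exponentMeasure, ← lintegral_spectralIntensity_mul
    (G := fun z => ∫⁻ w, 1 - B.indicator 1 (z • w) ∂(Q.map (W 0))) hm.lintegral_prod_right' hc]
  refine lintegral_congr fun z => lintegral_congr fun w => ?_
  rw [mul_smul]
  rfl

/-- With the integrals swapped, the inner one is the mass of `{z | t < z * w j}`, that is `w j / t`,
and `w j` has mean `1`. -/
lemma IsSpectralVector.exponentMeasure_setOf_le (h : IsSpectralVector Q ζ W) (j : Fin k)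
    {t : ℝ} (ht : 0 < t) :
    exponentMeasure Q W {v | v j ≤ t} = ENNReal.ofReal t⁻¹ := by
  have hB : MeasurableSet {v : Fin k → ℝ | v j ≤ t} :=
    measurableSet_le (measurable_pi_apply j) measurable_const
  have hm := measurable_one_sub_indicator_smul hB
  have hpm : IsProbabilityMeasure (Q.map (W 0)) :=
    Measure.isProbabilityMeasure_map (h.measurable 0).aemeasurable
  rw [exponentMeasure, lintegral_lintegral_swap hm.aemeasurable,
    lintegral_map hm.lintegral_prod_left' (h.measurable 0)]
  have h1 : ∀ ω, ∫⁻ z, 1 - {v : Fin k → ℝ | v j ≤ t}.indicator (1 : (Fin k → ℝ) → ℝ≥0∞) (z • W 0 ω)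
      ∂spectralIntensity = ENNReal.ofReal t⁻¹ * ENNReal.ofReal (W 0 ω j) := by
    intro ω
    rw [← spectralIntensity_setOf_lt_mul ht (h.nonneg 0 ω j), ← lintegral_indicator_one
      (show MeasurableSet {z : ℝ | t < z * W 0 ω j} from
        measurableSet_lt measurable_const (measurable_id.mul_const _))]
    refine lintegral_congr fun z => ?_
    by_cases hz : z * W 0 ω j ≤ t <;> simp [Set.indicator, hz]
  simp_rw [h1]
  rw [lintegral_const_mul' _ _ ENNReal.ofReal_ne_top,
    h.lintegral_eq_one, mul_one]

/-- Campbell's formula for the marked points, using that `ζ i` and `W i` are independent. -/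
lemma IsSpectralVector.tsum_measure (h : IsSpectralVector Q ζ W) {B : Set (Fin k → ℝ)}
    (hB : MeasurableSet B) :
    ∑' i, Q {ω | ζ i ω • W i ω ∉ B} = exponentMeasure Q W B := by
  have hm := measurable_one_sub_indicator_smul hB
  have hpm : IsProbabilityMeasure (Q.map (W 0)) :=
    Measure.isProbabilityMeasure_map (h.measurable 0).aemeasurable
  have h1 : ∀ i, Q {ω | ζ i ω • W i ω ∉ B} =
      ∫⁻ z, ∫⁻ w, 1 - B.indicator 1 (z • w) ∂(Q.map (W 0)) ∂(Q.map (ζ i)) := by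
    intro i
    have hζ := h.zeta_poisson.measurable i
    have hi : IndepFun (ζ i) (W i) Q :=
      h.indep_zeta.comp (φ := fun z : ℕ → ℝ => z i) (ψ := fun w : ℕ → Fin k → ℝ => w i)
        (measurable_pi_apply i) (measurable_pi_apply i)
    have hmap := (indepFun_iff_map_prod_eq_prod_map_map hζ.aemeasurable
      (h.measurable i).aemeasurable).1 hi
    rw [h.map_eq i] at hmap
    rw [← lintegral_prod (fun x : ℝ × (Fin k → ℝ) => 1 - B.indicator (1 : (Fin k → ℝ) → ℝ≥0∞) (x.1 • x.2))
      hm.aemeasurable, ← hmap, lintegral_map hm (hζ.prodMk (h.measurable i)),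
      ← lintegral_indicator_one (show MeasurableSet {ω | ζ i ω • W i ω ∉ B} from
        (hζ.smul (h.measurable i)) hB.compl)]
    refine lintegral_congr fun ω => ?_
    by_cases hω : ζ i ω • W i ω ∈ B <;> simp [Set.indicator, hω]
  simp_rw [h1]
  rw [← lintegral_sum_measure, h.zeta_poisson.sum_map]
  rfl

/-- Borel–Cantelli at each level `1 / (n + 1)`: the exceedance probabilities have the finite sum `n
+ 1`. -/
lemma IsSpectralVector.ae_finite (h : IsSpectralVector Q ζ W) :
    ∀ᵐ ω ∂Q, ∀ j, ∀ ε > 0, {i | ε < ζ i ω * W i ω j}.Finite := by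
  have h1 : ∀ᵐ ω ∂Q, ∀ j, ∀ n : ℕ, {i | 1 / ((n : ℝ) + 1) < ζ i ω * W i ω j}.Finite := by
    refine ae_all_iff.2 fun j => ae_all_iff.2 fun n => ?_
    have hn : 0 < 1 / ((n : ℝ) + 1) := by positivity
    refine ae_finite_setOfPred_mem (s := fun i => {ω | 1 / ((n : ℝ) + 1) < ζ i ω * W i ω j}) ?_
    have := h.tsum_measure (B := {v | v j ≤ 1 / ((n : ℝ) + 1)})
      (measurableSet_le (measurable_pi_apply j) measurable_const)
    rw [h.exponentMeasure_setOf_le j hn] at this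
    simp only [Set.mem_ofPred_eq, Pi.smul_apply, smul_eq_mul, not_le] at this
    rw [this]
    exact ENNReal.ofReal_ne_top
  filter_upwards [h1] with ω hω j ε hε
  obtain ⟨n, hn⟩ := exists_nat_one_div_lt hε
  exact (hω j n).subset fun i hi => hn.trans hi

end SpectralVector

/-! ### Maxima over all points and over the points with a given label. -/

section Maxima

variable {m k : ℕ} {Ω : Type*} {ζ : ℕ → Ω → ℝ} {W : ℕ → Ω → Fin k → ℝ}

/-- The max-stable vector `max_i ζ i • W i`. -/
noncomputable def siteMax (ζ : ℕ → Ω → ℝ) (W : ℕ → Ω → Fin k → ℝ) (ω : Ω) : Fin k → ℝ :=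
  fun j => ⨆ i, ζ i ω * W i ω j

/-- The vector `max_i ζ i • W i` of the points with label `a`. -/
noncomputable def labelledMax (ζ : ℕ → Ω → ℝ) (W : ℕ → Ω → Fin k → ℝ)
    (x : Ω × (ℕ → Fin m)) (a : Fin m) : Fin k → ℝ :=
  fun j => ⨆ i, if x.2 i = a then ζ i x.1 * W i x.1 j else 0

/-- Only finitely many of the values `ζ i * W i j` exceed any given level. -/
def FiniteExceedances (ζ : ℕ → Ω → ℝ) (W : ℕ → Ω → Fin k → ℝ) (ω : Ω) : Prop :=
  ∀ j, ∀ ε > 0, {i | ε < ζ i ω * W i ω j}.Finite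

lemma FiniteExceedances.labelled {ω : Ω} (hω : FiniteExceedances ζ W ω) (L : ℕ → Fin m)
    (a : Fin m) (j : Fin k) :
    ∀ ε > 0, {i | ε < if L i = a then ζ i ω * W i ω j else 0}.Finite := fun ε hε =>
  (hω j ε hε).subset fun i hi => by
    simp only [Set.mem_ofPred_eq] at hi ⊢
    split_ifs at hi
    exacts [hi, absurd hi hε.le.not_gt]

lemma FiniteExceedances.siteMax_le_iff {ω : Ω} (hω : FiniteExceedances ζ W ω) (y : Fin k → ℝ) :
    siteMax ζ W ω ≤ y ↔ ∀ i, ζ i ω • W i ω ≤ y := by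
  simp only [siteMax, Pi.le_def, ciSup_le_iff (bddAbove_of_finite_setOf_lt (hω _)),
    Pi.smul_apply, smul_eq_mul]
  exact forall_comm

/-- Points with another label enter the supremum as `0`, which is why `y` has to be nonnegative. -/
lemma FiniteExceedances.labelledMax_le_iff {ω : Ω} (hω : FiniteExceedances ζ W ω)
    (L : ℕ → Fin m) {y : Fin m → Fin k → ℝ} (hy : ∀ a j, 0 ≤ y a j) :
    (∀ a, labelledMax ζ W (ω, L) a ≤ y a) ↔ ∀ i, ζ i ω • W i ω ≤ y (L i) := by
  simp only [labelledMax, Pi.le_def, ciSup_le_iff (bddAbove_of_finite_setOf_lt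
    (hω.labelled L _ _)), Pi.smul_apply, smul_eq_mul]
  constructor
  · intro hx i j
    simpa using hx (L i) j i
  · intro hx a j i
    split_ifs with hi
    · exact hi ▸ hx i j
    · exact hy a j

variable [MeasurableSpace Ω] {Q : Measure Ω}

lemma measurableSet_setOf_label_eq (i : ℕ) (a : Fin m) :
    MeasurableSet {x : Ω × (ℕ → Fin m) | x.2 i = a} :=
  (show Measurable (fun x : Ω × (ℕ → Fin m) => x.2 i) from
    (measurable_pi_apply i).comp measurable_snd) (MeasurableSet.singleton a)

lemma IsSpectralVector.measurable_siteMax (h : IsSpectralVector Q ζ W) :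
    Measurable (siteMax ζ W) :=
  measurable_pi_lambda _ fun j => Measurable.iSup fun i => h.measurable_mul i j

lemma IsSpectralVector.measurable_labelledMax (h : IsSpectralVector Q ζ W) :
    Measurable (labelledMax (m := m) ζ W) :=
  measurable_pi_lambda _ fun a => measurable_pi_lambda _ fun j => Measurable.iSup fun i =>
    Measurable.ite (measurableSet_setOf_label_eq i a)
      ((h.measurable_mul i j).comp measurable_fst) measurable_const

lemma IsSpectralVector.siteMax_nonneg (h : IsSpectralVector Q ζ W) (ω : Ω) (j : Fin k) :
    0 ≤ siteMax ζ W ω j :=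
  Real.iSup_nonneg fun i => mul_nonneg (h.zeta_pos i ω).le (h.nonneg i ω j)

lemma IsSpectralVector.ite_nonneg (h : IsSpectralVector Q ζ W)
    (x : Ω × (ℕ → Fin m)) (a : Fin m) (i : ℕ) (j : Fin k) :
    0 ≤ if x.2 i = a then ζ i x.1 * W i x.1 j else 0 := by
  split_ifs
  exacts [mul_nonneg (h.zeta_pos _ _).le (h.nonneg _ _ _), le_rfl]

lemma IsSpectralVector.labelledMax_nonneg (h : IsSpectralVector Q ζ W)
    (x : Ω × (ℕ → Fin m)) (a : Fin m) (j : Fin k) :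
    0 ≤ labelledMax ζ W x a j :=
  Real.iSup_nonneg fun i => h.ite_nonneg x a i j

end Maxima

/-! ### Random labels and max-stability. -/

/-- The uniform distribution on the labels `0, …, m - 1`. -/
noncomputable def labelLaw (m : ℕ) : Measure (Fin m) := (m : ℝ≥0∞)⁻¹ • Measure.count

lemma labelLaw_apply {m : ℕ} (S : Set (Fin m)) :
    labelLaw m S = (m : ℝ≥0∞)⁻¹ * ∑ a, S.indicator 1 a := by
  rw [labelLaw, Measure.smul_apply, smul_eq_mul, ← lintegral_indicator_one MeasurableSet.of_discrete,
    lintegral_count, tsum_fintype]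

lemma labelLaw_singleton {m : ℕ} (a : Fin m) : labelLaw m {a} = (m : ℝ≥0∞)⁻¹ := by
  simp [labelLaw]

section Labels

variable {m : ℕ} [NeZero m]

instance : IsProbabilityMeasure (labelLaw m) where
  measure_univ := by
    rw [labelLaw_apply]
    simpa using ENNReal.inv_mul_cancel (by simpa using NeZero.ne m) (ENNReal.natCast_ne_top m)

/-- The law of a sequence of independent uniform labels. -/
noncomputable def labelSeqLaw (m : ℕ) [NeZero m] : Measure (ℕ → Fin m) :=
  Measure.infinitePi (fun _ => labelLaw m)

instance : IsProbabilityMeasure (labelSeqLaw m) := by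
  unfold labelSeqLaw; infer_instance

lemma labelSeqLaw_pi (s : Finset ℕ) (S : ℕ → Set (Fin m)) :
    labelSeqLaw m (Set.pi s S) = ∏ i ∈ s, labelLaw m (S i) :=
  Measure.infinitePi_pi _ fun _ _ => MeasurableSet.of_discrete

lemma labelSeqLaw_setOf_forall_eq (s : Finset ℕ) (a : Fin m) :
    labelSeqLaw m {L | ∀ i ∈ s, L i = a} = (m : ℝ≥0∞)⁻¹ ^ s.card := by
  have := labelSeqLaw_pi s (fun _ => {a})
  simp only [labelLaw_singleton, Finset.prod_const] at this
  rw [← this]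
  rfl

/-- The probability that independent uniform labels agree on a nonempty finite set. -/
lemma labelSeqLaw_setOf_exists_forall_eq {s : Finset ℕ} (hs : s.Nonempty) :
    labelSeqLaw m {L | ∃ a, ∀ i ∈ s, L i = a} = m * (m : ℝ≥0∞)⁻¹ ^ s.card := by
  have h1 : {L : ℕ → Fin m | ∃ a, ∀ i ∈ s, L i = a} = ⋃ a, {L | ∀ i ∈ s, L i = a} := by
    ext L; simp
  have hmeas : ∀ a : Fin m, MeasurableSet {L : ℕ → Fin m | ∀ i ∈ s, L i = a} := fun a =>
    MeasurableSet.pi s.countable_toSet (t := fun _ => {a}) fun _ _ => MeasurableSet.of_discrete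
  have hd : Pairwise (fun a b : Fin m =>
      Disjoint {L : ℕ → Fin m | ∀ i ∈ s, L i = a} {L | ∀ i ∈ s, L i = b}) := by
    obtain ⟨i, hi⟩ := hs
    exact fun a b hab => Set.disjoint_left.2 fun L ha hb => hab ((ha i hi).symm.trans (hb i hi))
  rw [h1, measure_iUnion hd hmeas, tsum_fintype]
  simp [labelSeqLaw_setOf_forall_eq]

variable {Ω : Type*} [MeasurableSpace Ω] {k : ℕ} {Q : Measure Ω} [IsProbabilityMeasure Q]
  {ζ : ℕ → Ω → ℝ} {W : ℕ → Ω → Fin k → ℝ}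

/-- The void probabilities of a randomly labelled process. -/
lemma IsSpectralVector.prod_labelSeqLaw_setOf_forall_mem (h : IsSpectralVector Q ζ W)
    {B : Fin m → Set (Fin k → ℝ)} (hB : ∀ a, MeasurableSet (B a)) :
    (Q.prod (labelSeqLaw m)) {x | ∀ i, ζ i x.1 • W i x.1 ∈ B (x.2 i)} =
      ∏ a, negExp ((m : ℝ≥0∞)⁻¹ * exponentMeasure Q W (B a)) := by
  have hm0 : (m : ℝ≥0∞) ≠ 0 := by simpa using NeZero.ne m
  have hmt : (m : ℝ≥0∞) ≠ ∞ := ENNReal.natCast_ne_top m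
  have hv : ∀ i, Measurable (fun ω => ζ i ω • W i ω) := fun i =>
    (h.zeta_poisson.measurable i).smul (h.measurable i)
  have hE : ∀ i, MeasurableSet
      {x : Ω × (ℕ → Fin m) | ζ i x.1 • W i x.1 ∈ B (x.2 i)} := by
    intro i
    have h1 : {x : Ω × (ℕ → Fin m) | ζ i x.1 • W i x.1 ∈ B (x.2 i)} =
        ⋃ a, {x | x.2 i = a} ∩ {x | ζ i x.1 • W i x.1 ∈ B a} := by
      ext x; simp
    rw [h1]
    refine MeasurableSet.iUnion fun a => MeasurableSet.inter ?_ ?_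
    · exact measurableSet_setOf_label_eq i a
    · exact ((hv i).comp measurable_fst) (hB a)
  have hEM : ∀ M : ℕ, MeasurableSet
      {x : Ω × (ℕ → Fin m) | ∀ i ∈ Finset.range M, ζ i x.1 • W i x.1 ∈ B (x.2 i)} := by
    intro M
    simp only [Set.ofPred_forall]
    exact MeasurableSet.iInter fun i => MeasurableSet.iInter fun _ => hE i
  -- The conditional probability, over its label only, that a given point lies in the set attached
  -- to that label.
  let φ : ℝ × (Fin k → ℝ) → ℝ≥0∞ := fun y =>
    (m : ℝ≥0∞)⁻¹ * ∑ a, (B a).indicator 1 (y.1 • y.2)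
  have hφ : Measurable φ := measurable_const.mul (Finset.measurable_sum _ fun a _ =>
    (measurable_one.indicator (hB a)).comp (measurable_fst.smul measurable_snd))
  have hone : (m : ℝ≥0∞)⁻¹ * ∑ _a : Fin m, 1 = 1 := by
    simpa using ENNReal.inv_mul_cancel hm0 hmt
  have hφ1 : ∀ y, φ y ≤ 1 := by
    intro y
    refine le_trans ?_ hone.le
    refine mul_le_mul_right (Finset.sum_le_sum fun a _ => ?_) _
    exact Set.indicator_le_self' (fun _ _ => zero_le) _
  have hsub : ∀ y, 1 - φ y = (m : ℝ≥0∞)⁻¹ * ∑ a, (1 - (B a).indicator 1 (y.1 • y.2)) := by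
    intro y
    refine (ENNReal.eq_sub_of_add_eq ((hφ1 y).trans_lt ENNReal.one_lt_top).ne ?_).symm
    rw [← mul_add, ← Finset.sum_add_distrib]
    refine Eq.trans ?_ hone
    refine congrArg _ (Finset.sum_congr rfl fun a _ => ?_)
    have h1 : (B a).indicator (1 : (Fin k → ℝ) → ℝ≥0∞) (y.1 • y.2) ≤ 1 :=
      Set.indicator_le_self' (fun _ _ => zero_le) _
    exact tsub_add_cancel_of_le h1
  have h1 : {x : Ω × (ℕ → Fin m) | ∀ i, ζ i x.1 • W i x.1 ∈ B (x.2 i)} =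
      ⋂ M, {x | ∀ i ∈ Finset.range M, ζ i x.1 • W i x.1 ∈ B (x.2 i)} := by
    ext x
    simp only [Set.mem_ofPred_eq, Set.mem_iInter, Finset.mem_range]
    exact ⟨fun hx M i _ => hx i, fun hx i => hx (i + 1) i (Nat.lt_succ_self i)⟩
  have hpm : IsProbabilityMeasure (Q.map (W 0)) :=
    Measure.isProbabilityMeasure_map (h.measurable 0).aemeasurable
  rw [h1, Antitone.measure_iInter (s := fun M : ℕ => {x : Ω × (ℕ → Fin m) |
      ∀ i ∈ Finset.range M, ζ i x.1 • W i x.1 ∈ B (x.2 i)})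
    (fun M M' hM x hx i hi => hx i (Finset.range_mono hM hi))
    (fun M => (hEM M).nullMeasurableSet) ⟨0, measure_ne_top _ _⟩]
  have h2 : ∀ M : ℕ, (Q.prod (labelSeqLaw m))
      {x | ∀ i ∈ Finset.range M, ζ i x.1 • W i x.1 ∈ B (x.2 i)} =
      ∫⁻ ω, ∏ i ∈ Finset.range M, φ (ζ i ω, W i ω) ∂Q := by
    intro M
    rw [Measure.prod_apply (hEM M)]
    refine lintegral_congr fun ω => ?_
    have := labelSeqLaw_pi (m := m) (Finset.range M) (fun i => {a | ζ i ω • W i ω ∈ B a})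
    simp_rw [labelLaw_apply] at this
    exact this
  simp_rw [h2]
  rw [h.zeta_poisson.iInf_lintegral_prod_marked h.measurable h.indep h.map_eq h.indep_zeta hφ hφ1,
    ← negExp_sum, ← Finset.mul_sum]
  congr 1
  have h3 : ∀ z, ∫⁻ w, 1 - φ (z, w) ∂(Q.map (W 0)) =
      (m : ℝ≥0∞)⁻¹ * ∑ a, ∫⁻ w, 1 - (B a).indicator 1 (z • w) ∂(Q.map (W 0)) := by
    intro z
    simp_rw [hsub]
    rw [lintegral_const_mul' _ _ (ENNReal.inv_ne_top.2 hm0), lintegral_finsetSum]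
    exact fun a _ => (measurable_one_sub_indicator_smul (hB a)).comp measurable_prodMk_left
  simp_rw [h3]
  rw [lintegral_const_mul' _ _ (ENNReal.inv_ne_top.2 hm0), lintegral_finsetSum]
  · rfl
  · exact fun a _ => (measurable_one_sub_indicator_smul (hB a)).lintegral_prod_right'

/-- With a single label the labelling is trivial. -/
lemma IsSpectralVector.measure_setOf_forall_mem (h : IsSpectralVector Q ζ W)
    {B : Set (Fin k → ℝ)} (hB : MeasurableSet B) :
    Q {ω | ∀ i, ζ i ω • W i ω ∈ B} = negExp (exponentMeasure Q W B) := by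
  have h1 := h.prod_labelSeqLaw_setOf_forall_mem (m := 1) (B := fun _ => B) (fun _ => hB)
  have h2 : {x : Ω × (ℕ → Fin 1) | ∀ i, ζ i x.1 • W i x.1 ∈ B} =
      {ω | ∀ i, ζ i ω • W i ω ∈ B} ×ˢ Set.univ := by
    ext x; simp
  rw [h2, Measure.prod_prod] at h1
  simpa using h1

lemma IsSpectralVector.measure_siteMax_mem_Iic (h : IsSpectralVector Q ζ W) (y : Fin k → ℝ) :
    Q {ω | siteMax ζ W ω ∈ Set.Iic y} = negExp (exponentMeasure Q W (Set.Iic y)) := by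
  rw [← h.measure_setOf_forall_mem measurableSet_Iic]
  refine measure_congr ?_
  filter_upwards [h.ae_finite] with ω hω
  exact propext (FiniteExceedances.siteMax_le_iff hω y)

/-- Max-stability: dividing the points at random into `m` classes produces `m` independent copies
of the max-stable vector, up to the scale `m`. -/
lemma IsSpectralVector.map_labelledMax (h : IsSpectralVector Q ζ W) :
    (Q.prod (labelSeqLaw m)).map (fun x a => (m : ℝ) • labelledMax ζ W x a) =
      Measure.pi (fun _ => Q.map (siteMax ζ W)) := by
  have hm0 : (0 : ℝ) < m := by exact_mod_cast NeZero.pos m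
  have hpm : IsProbabilityMeasure (Q.map (siteMax ζ W)) :=
    Measure.isProbabilityMeasure_map h.measurable_siteMax.aemeasurable
  have hmeas : Measurable (fun (x : Ω × (ℕ → Fin m)) a => (m : ℝ) • labelledMax ζ W x a) :=
    h.measurable_labelledMax.const_smul (m : ℝ)
  let C : Set (Set (Fin k → ℝ)) := Set.range Set.Iic
  -- Lower orthants generate the product σ-algebra and form a π-system, so comparing joint
  -- distribution functions suffices.
  have hgen : MeasurableSpace.generateFrom C = MeasurableSpace.pi := by
    have h1 : IsCountablySpanning (Set.range (Set.Iic : ℝ → Set ℝ)) :=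
      ⟨fun n : ℕ => Set.Iic (n : ℝ), fun n => ⟨_, rfl⟩,
        Set.eq_univ_of_forall fun y => Set.mem_iUnion.2 (exists_nat_ge y)⟩
    have h2 : MeasurableSpace.generateFrom (Set.range (Set.Iic : ℝ → Set ℝ)) =
        Real.measurableSpace := by
      rw [← borel_eq_generateFrom_Iic, BorelSpace.measurable_eq (α := ℝ)]
    rw [← generateFrom_eq_pi (fun _ : Fin k => h2) (fun _ => h1)]
    congr 1
    ext S
    constructor
    · rintro ⟨y, rfl⟩
      exact ⟨fun j => Set.Iic (y j), fun j _ => ⟨_, rfl⟩, Set.pi_univ_Iic y⟩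
    · rintro ⟨S, hS, rfl⟩
      choose y hy using fun j => hS j (Set.mem_univ j)
      obtain rfl : (fun j => Set.Iic (y j)) = S := funext hy
      exact ⟨y, (Set.pi_univ_Iic y).symm⟩
  have hpi : IsPiSystem C := by
    rintro _ ⟨y, rfl⟩ _ ⟨y', rfl⟩ _
    exact ⟨y ⊓ y', Set.Iic_inter_Iic.symm⟩
  have hspan : (⋃ n : ℕ, Set.Iic (fun _ : Fin k => (n : ℝ))) = Set.univ := by
    refine Set.eq_univ_of_forall fun y => Set.mem_iUnion.2 ?_
    obtain ⟨n, hn⟩ := exists_nat_ge (∑ j, |y j|)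
    exact ⟨n, fun j => (le_abs_self _).trans ((Finset.single_le_sum (f := fun j => |y j|)
      (fun _ _ => abs_nonneg _) (Finset.mem_univ j)).trans hn)⟩
  symm
  refine Measure.pi_eq_generateFrom (C := fun _ => C) (fun _ => hgen) (fun _ => hpi)
    (fun _ => ⟨fun n => Set.Iic (fun _ => (n : ℝ)), fun n => ⟨_, rfl⟩, fun n => measure_lt_top _ _,
      hspan⟩) fun S hS => ?_
  choose y hy using hS
  obtain rfl : (fun a => Set.Iic (y a)) = S := funext hy
  rw [Measure.map_apply hmeas (MeasurableSet.univ_pi fun a => measurableSet_Iic)]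
  simp_rw [Measure.map_apply h.measurable_siteMax measurableSet_Iic]
  -- For nonnegative `y` the factor `m` from scaling cancels the `m⁻¹` from thinning. If some `y a
  -- j` is negative both sides vanish, since the maxima are nonnegative.
  by_cases hpos : ∀ a j, 0 ≤ y a j
  · have h1 : ∀ a, MeasurableSet {v : Fin k → ℝ | (m : ℝ) • v ∈ Set.Iic (y a)} := fun a =>
      (measurable_const_smul (m : ℝ)) measurableSet_Iic
    have h2 := h.prod_labelSeqLaw_setOf_forall_mem h1
    simp_rw [exponentMeasure_smul (Q := Q) (W := W) (measurableSet_Iic (a := y _)) hm0] at h2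
    have h3 : ∀ t : ℝ≥0∞, (m : ℝ≥0∞)⁻¹ * (ENNReal.ofReal m * t) = t := by
      intro t
      rw [ENNReal.ofReal_natCast, ← mul_assoc, ENNReal.inv_mul_cancel
        (by simpa using NeZero.ne m) (ENNReal.natCast_ne_top m), one_mul]
    simp_rw [h3, ← h.measure_siteMax_mem_Iic] at h2
    refine Eq.trans (measure_congr ?_) h2
    have hae : ∀ᵐ x ∂(Q.prod (labelSeqLaw m)), FiniteExceedances ζ W x.1 :=
      Measure.quasiMeasurePreserving_fst.ae h.ae_finite
    filter_upwards [hae] with x hx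
    refine propext ?_
    have h4 : ∀ a j, 0 ≤ (m : ℝ)⁻¹ * y a j := fun a j =>
      mul_nonneg (inv_nonneg.2 hm0.le) (hpos a j)
    have h5 : ∀ v w : Fin k → ℝ, (m : ℝ) • v ≤ w ↔ v ≤ fun j => (m : ℝ)⁻¹ * w j := by
      intro v w
      simp only [Pi.le_def, Pi.smul_apply, smul_eq_mul, inv_mul_eq_div, le_div_iff₀' hm0]
    have h6 := hx.labelledMax_le_iff x.2 (y := fun a j => (m : ℝ)⁻¹ * y a j) h4
    simp only [← h5] at h6
    exact ⟨fun hx i => h6.1 (fun a => hx a (Set.mem_univ a)) i, fun hx a _ => h6.2 hx a⟩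
  · push Not at hpos
    obtain ⟨a, j, haj⟩ := hpos
    rw [Finset.prod_eq_zero (Finset.mem_univ a)]
    · convert measure_empty (μ := Q.prod (labelSeqLaw m))
      refine Set.eq_empty_of_forall_notMem fun x hx => ?_
      exact ((mul_nonneg hm0.le (h.labelledMax_nonneg x a j)).trans
        (hx a (Set.mem_univ a) j)).not_gt haj
    · convert measure_empty (μ := Q)
      refine Set.eq_empty_of_forall_notMem fun ω hω => ?_
      exact ((h.siteMax_nonneg ω j).trans (hω j)).not_gt haj

end Labels

/-! ### Margins, and the points that attain the maxima. -/

section Marginals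

variable {Ω : Type*} [MeasurableSpace Ω] {k : ℕ} {Q : Measure Ω}
  {ζ : ℕ → Ω → ℝ} {W : ℕ → Ω → Fin k → ℝ}

variable {m : ℕ}

lemma IsSpectralVector.labelledMax_le (h : IsSpectralVector Q ζ W) {ω : Ω}
    (hω : FiniteExceedances ζ W ω) (L : ℕ → Fin m) (a : Fin m) (j : Fin k) :
    labelledMax ζ W (ω, L) a j ≤ siteMax ζ W ω j := by
  refine ciSup_le fun i => ?_
  split_ifs
  · exact le_ciSup (f := fun i => ζ i ω * W i ω j) (bddAbove_of_finite_setOf_lt (hω j)) i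
  · exact h.siteMax_nonneg ω j

lemma IsSpectralVector.labelledMax_eq (h : IsSpectralVector Q ζ W) {ω : Ω}
    (hω : FiniteExceedances ζ W ω) {L : ℕ → Fin m} {a : Fin m} {j : Fin k} {i : ℕ}
    (hi : ζ i ω * W i ω j = siteMax ζ W ω j) (hL : L i = a) :
    labelledMax ζ W (ω, L) a j = siteMax ζ W ω j := by
  refine le_antisymm (h.labelledMax_le hω L a j) ?_
  have := le_ciSup (bddAbove_of_finite_setOf_lt (hω.labelled L a j)) i
  rw [if_pos hL, hi] at this
  exact this

/-- The number of the points that attain the maximum at some of the sites. -/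
noncomputable def hitCount (ζ : ℕ → Ω → ℝ) (W : ℕ → Ω → Fin k → ℝ) (ω : Ω) : ℝ≥0∞ :=
  ∑' i, {ω | ∃ j, ζ i ω * W i ω j = siteMax ζ W ω j}.indicator 1 ω

lemma IsSpectralVector.measurable_hitCount (h : IsSpectralVector Q ζ W) :
    Measurable (hitCount ζ W) := by
  refine Measurable.tsum fun i => measurable_one.indicator ?_
  simp only [Set.ofPred_exists]
  exact MeasurableSet.iUnion fun j => measurableSet_eq_fun (h.measurable_mul i j)
    ((measurable_pi_apply j).comp h.measurable_siteMax)

lemma measurableSet_sampleConcurrent :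
    MeasurableSet {x : Fin m → Fin k → ℝ | SampleConcurrent x} := by
  simp only [SampleConcurrent, Set.ofPred_exists, Set.ofPred_forall]
  exact MeasurableSet.iUnion fun l => MeasurableSet.iInter fun i => MeasurableSet.iInter fun j =>
    measurableSet_le ((measurable_pi_apply j).comp (measurable_pi_apply i))
      ((measurable_pi_apply j).comp (measurable_pi_apply l))

variable [IsProbabilityMeasure Q]

/-- The margins of the max-stable vector are standard Fréchet. -/
lemma IsSpectralVector.measure_siteMax_le (h : IsSpectralVector Q ζ W) (j : Fin k) {t : ℝ}
    (ht : 0 < t) : Q {ω | siteMax ζ W ω j ≤ t} = negExp (ENNReal.ofReal t⁻¹) := by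
  rw [← h.exponentMeasure_setOf_le j ht, ← h.measure_setOf_forall_mem
    (measurableSet_le (measurable_pi_apply j) measurable_const)]
  refine measure_congr ?_
  filter_upwards [h.ae_finite] with ω hω
  exact propext (ciSup_le_iff (bddAbove_of_finite_setOf_lt (hω j)))

lemma IsSpectralVector.measure_siteMax_le_zero (h : IsSpectralVector Q ζ W) (j : Fin k) :
    Q {ω | siteMax ζ W ω j ≤ 0} = 0 := by
  have h1 : Tendsto (fun t : ℝ => negExp (ENNReal.ofReal t⁻¹)) (𝓝[>] 0) (𝓝 (negExp ∞)) :=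
    (continuous_negExp.tendsto _).comp (ENNReal.tendsto_ofReal_atTop.comp tendsto_inv_nhdsGT_zero)
  rw [negExp_top] at h1
  refine le_antisymm (ge_of_tendsto h1 ?_) zero_le
  filter_upwards [self_mem_nhdsWithin] with t ht
  rw [← h.measure_siteMax_le j ht]
  exact measure_mono fun ω (hω : siteMax ζ W ω j ≤ 0) =>
    show siteMax ζ W ω j ≤ t from hω.trans (le_of_lt ht)

/-- The Fréchet distribution function is continuous: an atom at `t > 0` would be a jump between `s`
and `t` that persists as `s ↑ t`. -/
lemma IsSpectralVector.measure_siteMax_eq (h : IsSpectralVector Q ζ W) (j : Fin k) (t : ℝ) :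
    Q {ω | siteMax ζ W ω j = t} = 0 := by
  rcases le_or_gt t 0 with ht | ht
  · exact measure_mono_null (fun ω hω => le_trans (le_of_eq hω) ht) (h.measure_siteMax_le_zero j)
  have hm : ∀ s, MeasurableSet {ω | siteMax ζ W ω j ≤ s} := fun s =>
    measurableSet_le ((measurable_pi_apply j).comp h.measurable_siteMax) measurable_const
  have h1 : Tendsto (fun s : ℝ => Q {ω | siteMax ζ W ω j = t} + negExp (ENNReal.ofReal s⁻¹))
      (𝓝[<] t) (𝓝 (Q {ω | siteMax ζ W ω j = t} + negExp (ENNReal.ofReal t⁻¹))) := by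
    refine Tendsto.add tendsto_const_nhds ((continuous_negExp.tendsto _).comp
      ((ENNReal.continuous_ofReal.tendsto _).comp ?_))
    exact (tendsto_inv₀ ht.ne').mono_left nhdsWithin_le_nhds
  have h2 : Q {ω | siteMax ζ W ω j = t} + negExp (ENNReal.ofReal t⁻¹) ≤
      negExp (ENNReal.ofReal t⁻¹) := by
    refine le_of_tendsto h1 ?_
    filter_upwards [Ioo_mem_nhdsLT ht] with s hs
    rw [← h.measure_siteMax_le j hs.1, ← h.measure_siteMax_le j ht, ← measure_union _ (hm s)]
    · refine measure_mono ?_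
      rintro ω (hω | hω)
      exacts [le_of_eq hω, le_trans hω hs.2.le]
    · refine Set.disjoint_left.2 fun ω hω hω' => ?_
      exact ((show siteMax ζ W ω j = t from hω) ▸ (show siteMax ζ W ω j ≤ s from hω')).not_gt hs.2
  rw [← h.measure_siteMax_le j ht] at h2
  have h3 : Q {ω | siteMax ζ W ω j = t} + Q {ω | siteMax ζ W ω j ≤ t} ≤
      0 + Q {ω | siteMax ζ W ω j ≤ t} := by simpa using h2
  exact le_antisymm (ENNReal.le_of_add_le_add_right (measure_ne_top _ _) h3) zero_le

lemma IsSpectralVector.ae_siteMax_pos (h : IsSpectralVector Q ζ W) :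
    ∀ᵐ ω ∂Q, ∀ j, 0 < siteMax ζ W ω j := by
  refine ae_all_iff.2 fun j => ?_
  have := h.measure_siteMax_le_zero j
  rw [ae_iff]
  simpa using this

/-- Almost surely each maximum is attained by only one of the points. -/
lemma IsSpectralVector.ae_unique (h : IsSpectralVector Q ζ W) :
    ∀ᵐ ω ∂Q, ∀ j i l, ζ i ω * W i ω j = siteMax ζ W ω j → ζ l ω * W l ω j = siteMax ζ W ω j →
      i = l := by
  refine ae_all_iff.2 fun j => ?_
  have hpm : IsProbabilityMeasure (Q.map (siteMax ζ W)) :=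
    Measure.isProbabilityMeasure_map h.measurable_siteMax.aemeasurable
  have hcoord : ∀ a : Fin 2, Measurable (fun y : Fin 2 → Fin k → ℝ => y a j) := fun a =>
    (measurable_pi_apply j).comp (measurable_pi_apply a)
  have hS : MeasurableSet {y : Fin 2 → Fin k → ℝ | y 0 j = y 1 j} :=
    measurableSet_eq_fun (hcoord 0) (hcoord 1)
  have hS' : MeasurableSet {y : (Fin k → ℝ) × (Fin k → ℝ) | y.1 j = y.2 j} :=
    measurableSet_eq_fun ((measurable_pi_apply j).comp measurable_fst)
      ((measurable_pi_apply j).comp measurable_snd)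
  -- Two independent copies with atomless margins almost surely differ at site `j`; this is applied
  -- to the two classes of a labelling with `m = 2`.
  have h1 : Measure.pi (fun _ : Fin 2 => Q.map (siteMax ζ W)) {y | y 0 j = y 1 j} = 0 := by
    have h2 := (measurePreserving_finTwoArrow (Q.map (siteMax ζ W))).measure_preimage
      hS'.nullMeasurableSet
    refine Eq.trans h2 ?_
    rw [Measure.measure_prod_null hS']
    refine ae_of_all _ fun y => ?_
    have h3 : MeasurableSet {v : Fin k → ℝ | y j = v j} :=
      measurableSet_eq_fun measurable_const (measurable_pi_apply j)
    refine (Measure.map_apply h.measurable_siteMax h3).trans ?_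
    simpa [eq_comm] using h.measure_siteMax_eq j (y j)
  have hmeas : Measurable (fun (x : Ω × (ℕ → Fin 2)) a => ((2 : ℕ) : ℝ) • labelledMax ζ W x a) :=
    h.measurable_labelledMax.const_smul ((2 : ℕ) : ℝ)
  rw [← h.map_labelledMax, Measure.map_apply hmeas hS] at h1
  have h4 := Measure.ae_ae_of_ae_prod (measure_eq_zero_iff_ae_notMem.1 h1)
  filter_upwards [h4, h.ae_finite] with ω hω hfin i l hi hl
  by_contra hil
  -- If distinct points `i` and `l` both attained the maximum, giving them labels `0` and `1` would
  -- make the class maxima agree at `j`. That label event has positive probability, but it lies in a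
  -- null set.
  have h5 : labelSeqLaw 2 (Set.pi ({i, l} : Finset ℕ) (fun n => if n = i then {0} else {1})) = 0 := by
    refine measure_mono_null (fun L hL => ?_) hω
    have hLi : L i = 0 := by simpa using hL i (by simp)
    have hLl : L l = 1 := by simpa [Ne.symm hil] using hL l (by simp)
    simp only [Set.mem_compl_iff, not_not, Set.mem_ofPred_eq, Set.mem_preimage, Pi.smul_apply]
    rw [h.labelledMax_eq hfin hi hLi, h.labelledMax_eq hfin hl hLl]
  rw [labelSeqLaw_pi, Finset.prod_eq_zero_iff] at h5
  obtain ⟨n, -, hn⟩ := h5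
  split_ifs at hn <;> simp [labelLaw_singleton] at hn

/-- Given the max-stable vector, sample concurrence for the randomly labelled points means that
the labels of the points attaining the maxima agree. -/
lemma IsSpectralVector.ae_hitCount (h : IsSpectralVector Q ζ W) (hk : 0 < k) :
    ∀ᵐ ω ∂Q, ∃ n ∈ Finset.range k, hitCount ζ W ω = (n + 1 : ℕ) ∧
      ((∃ l, ∀ j, siteMax ζ W ω j = ζ l ω * W l ω j) ↔ n = 0) ∧
      ∀ (m : ℕ) [NeZero m], labelSeqLaw m
        {L | SampleConcurrent (fun a => (m : ℝ) • labelledMax ζ W (ω, L) a)} =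
          (m : ℝ≥0∞)⁻¹ ^ n := by
  classical
  filter_upwards [h.ae_finite, h.ae_siteMax_pos, h.ae_unique] with ω hfin hpos huniq
  have hex : ∀ j, ∃ i, ζ i ω * W i ω j = siteMax ζ W ω j := fun j =>
    exists_eq_ciSup_of_finite_setOf_lt (hfin j) (hpos j)
  choose hit hhit using hex
  -- The points attaining a maximum; there are between `1` and `k` of them, and `n` below is `T.card
  -- - 1`.
  let T : Finset ℕ := Finset.univ.image hit
  have hT : ∀ i, i ∈ T ↔ ∃ j, ζ i ω * W i ω j = siteMax ζ W ω j := by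
    intro i
    simp only [T, Finset.mem_image, Finset.mem_univ, true_and]
    exact ⟨fun ⟨j, hj⟩ => ⟨j, hj ▸ hhit j⟩, fun ⟨j, hj⟩ => ⟨j, huniq j _ _ (hhit j) hj⟩⟩
  have hTne : T.Nonempty := ⟨hit ⟨0, hk⟩, Finset.mem_image_of_mem _ (Finset.mem_univ _)⟩
  have hcard : T.card - 1 + 1 = T.card := Nat.sub_add_cancel hTne.card_pos
  refine ⟨T.card - 1, Finset.mem_range.2 ?_, ?_, ?_, ?_⟩
  · have : T.card ≤ k := by simpa using Finset.card_image_le (s := Finset.univ) (f := hit)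
    omega
  · rw [hcard, hitCount, tsum_eq_sum (s := T)]
    · rw [Finset.sum_congr rfl fun i hi => show _ = (1 : ℝ≥0∞) from
        Set.indicator_of_mem (s := {ω | ∃ j, ζ i ω * W i ω j = siteMax ζ W ω j}) ((hT i).1 hi) 1]
      simp
    · exact fun i hi => Set.indicator_of_notMem
        (s := {ω | ∃ j, ζ i ω * W i ω j = siteMax ζ W ω j}) (fun hi' => hi ((hT i).2 hi')) 1
  · have : T.card - 1 = 0 ↔ T.card = 1 := by omega
    rw [this, Finset.card_eq_one]
    constructor
    · rintro ⟨l, hl⟩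
      refine ⟨l, Finset.eq_singleton_iff_nonempty_unique_mem.2 ⟨hTne, fun i hi => ?_⟩⟩
      obtain ⟨j, hj⟩ := (hT i).1 hi
      exact huniq j _ _ hj (hl j).symm
    · rintro ⟨l, hl⟩
      refine ⟨l, fun j => ?_⟩
      have : hit j ∈ T := Finset.mem_image_of_mem _ (Finset.mem_univ _)
      rw [hl, Finset.mem_singleton] at this
      rw [← this, hhit]
  · intro m hm
    have h0 : (m : ℝ≥0∞)⁻¹ ^ (T.card - 1) = m * (m : ℝ≥0∞)⁻¹ ^ T.card := by
      conv_rhs => rw [← hcard, pow_succ', ← mul_assoc, ENNReal.mul_inv_cancel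
        (by simpa using NeZero.ne m) (ENNReal.natCast_ne_top m), one_mul]
    rw [h0, ← labelSeqLaw_setOf_exists_forall_eq hTne]
    congr 1
    ext L
    have hm0 : (0 : ℝ) < m := by exact_mod_cast NeZero.pos m
    simp only [SampleConcurrent, Set.mem_ofPred_eq, Pi.smul_apply, smul_eq_mul,
      mul_le_mul_iff_right₀ hm0]
    refine exists_congr fun a => ⟨fun ha i hi => ?_, fun ha b j => ?_⟩
    · obtain ⟨j, hj⟩ := (hT i).1 hi
      -- The class of the point `i` reaches the overall maximum at `j`, hence so does the dominating
      -- class `a`. A point of class `a` attains this positive value, and by uniqueness it is `i`.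
      have h1 : siteMax ζ W ω j ≤ labelledMax ζ W (ω, L) a j := by
        rw [← h.labelledMax_eq hfin hj rfl]
        exact ha (L i) j
      have h2 : labelledMax ζ W (ω, L) a j = siteMax ζ W ω j :=
        le_antisymm (h.labelledMax_le hfin L a j) h1
      obtain ⟨l, hl⟩ := exists_eq_ciSup_of_finite_setOf_lt (FiniteExceedances.labelled hfin L a j)
        (show 0 < labelledMax ζ W (ω, L) a j from h2 ▸ hpos j)
      change _ = labelledMax ζ W (ω, L) a j at hl
      rw [h2] at hl
      split_ifs at hl with hla
      · rw [huniq j i l hj hl]; exact hla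
      · exact absurd hl (hpos j).ne
    · rw [h.labelledMax_eq hfin (hhit j)
        (ha _ (Finset.mem_image_of_mem _ (Finset.mem_univ _)))]
      exact h.labelledMax_le hfin L b j

/-- The sample concurrence probability is a polynomial in `1 / m`. -/
lemma IsSpectralVector.pi_sampleConcurrent (h : IsSpectralVector Q ζ W) (hk : 0 < k) [NeZero m] :
    Measure.pi (fun _ : Fin m => Q.map (siteMax ζ W)) {x | SampleConcurrent x} =
      ∑ n ∈ Finset.range k, Q {ω | hitCount ζ W ω = (n + 1 : ℕ)} * (m : ℝ≥0∞)⁻¹ ^ n := by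
  have hmeas : Measurable (fun (x : Ω × (ℕ → Fin m)) a => (m : ℝ) • labelledMax ζ W x a) :=
    h.measurable_labelledMax.const_smul (m : ℝ)
  have hn : ∀ n : ℕ, MeasurableSet {ω | hitCount ζ W ω = (n + 1 : ℕ)} := fun n =>
    h.measurable_hitCount (measurableSet_singleton _)
  rw [← h.map_labelledMax, Measure.map_apply hmeas measurableSet_sampleConcurrent,
    Measure.prod_apply (hmeas measurableSet_sampleConcurrent)]
  have h1 : ∀ᵐ ω ∂Q, labelSeqLaw m (Prod.mk ω ⁻¹'
      ((fun (x : Ω × (ℕ → Fin m)) a => (m : ℝ) • labelledMax ζ W x a) ⁻¹'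
        {x | SampleConcurrent x})) =
      ∑ n ∈ Finset.range k,
        {ω | hitCount ζ W ω = (n + 1 : ℕ)}.indicator (fun _ => (m : ℝ≥0∞)⁻¹ ^ n) ω := by
    filter_upwards [h.ae_hitCount hk] with ω ⟨n, hnk, hω, _, hL⟩
    refine (hL m).trans ?_
    rw [Finset.sum_eq_single n,
      Set.indicator_of_mem (s := {ω | hitCount ζ W ω = (n + 1 : ℕ)}) hω]
    · intro n' _ hne
      refine Set.indicator_of_notMem (fun hω' => hne ?_) _
      have := (show hitCount ζ W ω = (n' + 1 : ℕ) from hω').symm.trans hω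
      exact Nat.succ_injective (Nat.cast_injective this)
    · exact fun hn' => absurd hnk hn'
  rw [lintegral_congr_ae h1, lintegral_finsetSum _ fun n _ => measurable_const.indicator (hn n)]
  refine Finset.sum_congr rfl fun n _ => ?_
  rw [lintegral_indicator_const (hn n), mul_comm]

lemma IsSpectralVector.measure_exists_forall_eq (h : IsSpectralVector Q ζ W) (hk : 0 < k) :
    Q {ω | ∃ l, ∀ j, siteMax ζ W ω j = ζ l ω * W l ω j} = Q {ω | hitCount ζ W ω = (0 + 1 : ℕ)} := by
  refine measure_congr ?_
  filter_upwards [h.ae_hitCount hk] with ω ⟨n, _, hω, hiff, _⟩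
  refine propext (hiff.trans ?_)
  change _ ↔ hitCount ζ W ω = (0 + 1 : ℕ)
  rw [hω, Nat.cast_inj]
  omega

/-- The expansion at `m = 1`, where a single vector is always concurrent. -/
lemma IsSpectralVector.sum_measure_hitCount (h : IsSpectralVector Q ζ W) (hk : 0 < k) :
    ∑ n ∈ Finset.range k, Q {ω | hitCount ζ W ω = (n + 1 : ℕ)} = 1 := by
  have hpm : IsProbabilityMeasure (Q.map (siteMax ζ W)) :=
    Measure.isProbabilityMeasure_map h.measurable_siteMax.aemeasurable
  have h1 := h.pi_sampleConcurrent (m := 1) hk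
  have h2 : {x : Fin 1 → Fin k → ℝ | SampleConcurrent x} = Set.univ := by
    refine Set.eq_univ_of_forall fun x => ⟨0, fun i j => ?_⟩
    rw [Subsingleton.elim i 0]
  rw [h2, measure_univ] at h1
  simpa using h1.symm

end Marginals

/-! ### From the max-stable vector to the observed data. -/

section Transfer

variable {Ω' : Type*} [MeasurableSpace Ω'] {k : ℕ} {Q : Measure Ω'} [IsProbabilityMeasure Q]
  {ζ : ℕ → Ω' → ℝ} {W : ℕ → Ω' → Fin k → ℝ} {Ω : Type*} [MeasurableSpace Ω]
  {P : Measure Ω} {X : ℕ → Ω → Fin k → ℝ}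

/-- Sample concurrence is not affected by increasing transformations of the margins. -/
lemma IsSpectralVector.sampleProb_eq (h : IsSpectralVector Q ζ W) {g : Fin k → ℝ → ℝ}
    (hg : ∀ j, StrictMonoOn (g j) (Set.Ioi 0)) (hXm : ∀ i, Measurable (X i))
    (hXindep : iIndepFun X P)
    (hX : ∀ i, IdentDistrib (X i) (fun ω j => g j (siteMax ζ W ω j)) P Q) (m : ℕ) :
    sampleProb P X m =
      (Measure.pi (fun _ : Fin m => Q.map (siteMax ζ W))).real {x | SampleConcurrent x} := by
  have hP : IsProbabilityMeasure P := hXindep.isProbabilityMeasure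
  have hpm : IsProbabilityMeasure (Q.map (siteMax ζ W)) :=
    Measure.isProbabilityMeasure_map h.measurable_siteMax.aemeasurable
  have hgm := (hX 0).aemeasurable_snd
  have hpm' : IsProbabilityMeasure (Q.map (fun ω j => g j (siteMax ζ W ω j))) :=
    Measure.isProbabilityMeasure_map hgm
  have hmap := (iIndepFun_iff_map_fun_eq_pi_map (fun i : Fin m => (hXm i).aemeasurable)).1
    (hXindep.precomp Fin.val_injective)
  simp only [(hX _).map_eq] at hmap
  have hXm' : Measurable (fun ω (i : Fin m) => X i ω) := measurable_pi_lambda _ fun i => hXm i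
  rw [sampleProb, measureReal_def, measureReal_def]
  congr 1
  refine (Measure.map_apply hXm' measurableSet_sampleConcurrent).symm.trans ?_
  rw [hmap, ← Measure.pi_map_pi (fun _ => hgm), ← Measure.pi_map_pi (fun _ =>
    h.measurable_siteMax.aemeasurable),
    Measure.map_apply_of_aemeasurable _ measurableSet_sampleConcurrent,
    Measure.map_apply (show Measurable (fun (x : Fin m → Ω') i => siteMax ζ W (x i)) from
      measurable_pi_lambda _ fun i => h.measurable_siteMax.comp (measurable_pi_apply i))
      measurableSet_sampleConcurrent]
  · refine measure_congr ?_
    -- The transformations are increasing only on `(0, ∞)`, where the maxima almost surely lie.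
    have hae : ∀ᵐ ω ∂(Measure.pi fun _ : Fin m => Q), ∀ i j, 0 < siteMax ζ W (ω i) j :=
      ae_all_iff.2 fun i => (Measure.quasiMeasurePreserving_eval (fun _ : Fin m => Q) i).ae h.ae_siteMax_pos
    filter_upwards [hae] with ω hω
    refine propext (exists_congr fun l => forall_congr' fun i => forall_congr' fun j => ?_)
    exact (hg j).le_iff_le (hω i j) (hω l j)
  · exact aemeasurable_pi_lambda _ fun i =>
      hgm.comp_quasiMeasurePreserving (Measure.quasiMeasurePreserving_eval _ i)

/-- The expansion of the sample concurrence probability: its coefficients are the probabilities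
that the maxima at the sites are attained by exactly `n` of the points. -/
lemma IsSpectralVector.sampleProb_eq_sum (h : IsSpectralVector Q ζ W) (hk : 0 < k)
    {g : Fin k → ℝ → ℝ}
    (hg : ∀ j, StrictMonoOn (g j) (Set.Ioi 0)) (hXm : ∀ i, Measurable (X i))
    (hXindep : iIndepFun X P)
    (hX : ∀ i, IdentDistrib (X i) (fun ω j => g j (siteMax ζ W ω j)) P Q) {m : ℕ} (hm : 0 < m) :
    sampleProb P X m =
      ∑ n ∈ Finset.range k, Q.real {ω | hitCount ζ W ω = (n + 1 : ℕ)} / (m : ℝ) ^ n := by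
  have : NeZero m := ⟨hm.ne'⟩
  rw [h.sampleProb_eq hg hXm hXindep hX, measureReal_def, h.pi_sampleConcurrent hk,
    ENNReal.toReal_sum]
  · refine Finset.sum_congr rfl fun n _ => ?_
    rw [ENNReal.toReal_mul, ENNReal.toReal_pow, ENNReal.toReal_inv, ENNReal.toReal_natCast,
      inv_pow, div_eq_mul_inv]
    rfl
  · exact fun n _ => ENNReal.mul_ne_top (measure_ne_top _ _)
      (ENNReal.pow_ne_top (ENNReal.inv_ne_top.2 (by simpa using hm.ne')))

lemma IsSpectralVector.sum_measureReal_hitCount (h : IsSpectralVector Q ζ W) (hk : 0 < k) :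
    ∑ n ∈ Finset.range k, Q.real {ω | hitCount ζ W ω = (n + 1 : ℕ)} = 1 := by
  simp only [measureReal_def]
  rw [← ENNReal.toReal_sum (fun n _ => measure_ne_top _ _), h.sum_measure_hitCount hk,
    ENNReal.toReal_one]

end Transfer

/-! ### Asymptotics of the sample concurrence probability. -/

/-- The leading term of a polynomial in `1 / m` with nonnegative coefficients. -/
lemma exists_isEquivalent_of_eq_sum {k : ℕ} {q : ℕ → ℝ} (hq : ∀ n, 0 ≤ q n)
    (hsum : ∑ n ∈ Finset.range k, q n = 1) (hk : 0 < k) (hq0 : q 0 < 1) {f : ℕ → ℝ}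
    (hf : ∀ m, 0 < m → f m = ∑ n ∈ Finset.range k, q n / (m : ℝ) ^ n) :
    ∃ (r : ℕ) (c : ℝ), 1 ≤ r ∧ r ≤ k - 1 ∧ 0 < c ∧ c ≤ 1 - q 0 ∧
      (fun m => f m - q 0) ~[atTop] (fun m : ℕ => c / (m : ℝ) ^ r) := by
  classical
  have hrange : Finset.range k = insert 0 (Finset.Ico 1 k) := by
    ext n; simp only [Finset.mem_range, Finset.mem_insert, Finset.mem_Ico]; omega
  have hnotin : 0 ∉ Finset.Ico 1 k := by simp
  rw [hrange, Finset.sum_insert hnotin] at hsum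
  have hex : ∃ n, n ∈ Finset.Ico 1 k ∧ 0 < q n := by
    by_contra hne
    push Not at hne
    have : ∑ n ∈ Finset.Ico 1 k, q n ≤ 0 := Finset.sum_nonpos hne
    linarith
  -- The witnesses are the least index `r ≥ 1` with a positive coefficient, and `c = q r`.
  obtain ⟨hr, hqr⟩ := Nat.find_spec hex
  have hmin : ∀ n ∈ Finset.Ico 1 k, n < Nat.find hex → q n = 0 := fun n hn hlt =>
    le_antisymm (not_lt.1 fun h => Nat.find_min hex hlt ⟨hn, h⟩) (hq n)
  set r := Nat.find hex
  have hr' := Finset.mem_Ico.1 hr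
  refine ⟨r, q r, hr'.1, by omega, hqr, ?_, ?_⟩
  · have := Finset.single_le_sum (fun n _ => hq n) hr
    linarith
  · have h1 : (fun m : ℕ => ∑ n ∈ (Finset.Ico 1 k).erase r, q n / (m : ℝ) ^ n) =o[atTop]
        (fun m : ℕ => q r / (m : ℝ) ^ r) := by
      refine IsLittleO.fun_sum fun n hn => ?_
      obtain ⟨hnr, hn⟩ := Finset.mem_erase.1 hn
      rcases lt_or_gt_of_ne hnr with hlt | hgt
      · simp [hmin n hn hlt]
      · simp only [div_eq_mul_inv]
        refine (IsLittleO.const_mul_right hqr.ne' ?_).const_mul_left _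
        have h2 : (fun m : ℕ => (m : ℝ) ^ r) =o[atTop] (fun m : ℕ => (m : ℝ) ^ n) :=
          (isLittleO_pow_pow_atTop_of_lt hgt).comp_tendsto tendsto_natCast_atTop_atTop
        refine h2.inv_rev ?_
        filter_upwards [eventually_gt_atTop 0] with m hm h0
        exact absurd h0 (pow_ne_zero _ (by exact_mod_cast hm.ne'))
    refine h1.congr' ?_ EventuallyEq.rfl
    filter_upwards [eventually_gt_atTop 0] with m hm
    rw [Pi.sub_apply, hf m hm, hrange, Finset.sum_insert hnotin, ← Finset.add_sum_erase _ _ hr]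
    simp

/-! ### Limits of powers and of exponentials. -/

/-- Since `N → ∞` forces `g → 0`, `N * log (1 + g)` differs from `N * g` by a term tending to `0`.
-/
lemma tendsto_one_add_pow_exp {ι : Type*} {l : Filter ι} {N : ι → ℕ} {g : ι → ℂ} {t : ℂ}
    (hN : Tendsto N l atTop) (hg : Tendsto (fun i => (N i : ℂ) * g i) l (𝓝 t)) :
    Tendsto (fun i => (1 + g i) ^ N i) l (𝓝 (Complex.exp t)) := by
  have hNinv : Tendsto (fun i => ((N i : ℂ))⁻¹) l (𝓝 0) :=
    tendsto_inv_atTop_nhds_zero_nat.comp hN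
  have hN0 : ∀ᶠ i in l, (N i : ℂ) ≠ 0 := by
    filter_upwards [hN.eventually_gt_atTop 0] with i hi
    exact_mod_cast hi.ne'
  have hg0 : Tendsto g l (𝓝 0) := by
    have := hNinv.mul hg
    rw [zero_mul] at this
    refine this.congr' ?_
    filter_upwards [hN0] with i hi
    rw [inv_mul_cancel_left₀ hi]
  have hlog : (fun z : ℂ => Complex.log (1 + z) - z) =o[𝓝 0] (fun z : ℂ => z) := by
    have h1 : HasDerivAt (fun z : ℂ => Complex.log (1 + z)) 1 0 := by
      have := (Complex.hasStrictDerivAt_log (x := 1 + 0) (by simp)).hasDerivAt.comp_const_add 1 0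
      simpa using this
    have := hasDerivAt_iff_isLittleO_nhds_zero.1 h1
    simpa using this
  have h2 : (fun i => (N i : ℂ) * (Complex.log (1 + g i) - g i)) =o[l]
      (fun i => (N i : ℂ) * g i) := (isBigO_refl _ l).mul_isLittleO (hlog.comp_tendsto hg0)
  have h3 : Tendsto (fun i => (N i : ℂ) * (Complex.log (1 + g i) - g i)) l (𝓝 0) :=
    (isLittleO_one_iff ℂ).1 (h2.trans_isBigO (hg.isBigO_one ℂ))
  have h4 : Tendsto (fun i => (N i : ℂ) * Complex.log (1 + g i)) l (𝓝 t) := by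
    have := h3.add hg
    rw [zero_add] at this
    exact this.congr fun i => by ring
  refine (Complex.continuous_exp.tendsto _ |>.comp h4).congr' ?_
  have h5 : ∀ᶠ i in l, 1 + g i ≠ 0 := by
    have : Tendsto (fun i => 1 + g i) l (𝓝 (1 + 0)) := hg0.const_add 1
    exact this.eventually_ne (by simp)
  filter_upwards [h5] with i hi
  rw [Function.comp_apply, Complex.exp_nat_mul, Complex.exp_log hi]

lemma isBigO_cexp_sub :
    (fun x : ℝ => Complex.exp (x * Complex.I) - (1 + x * Complex.I - x ^ 2 / 2)) =O[𝓝 0]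
      (fun x : ℝ => x ^ 3) := by
  refine IsBigO.of_bound (Real.exp 1) ?_
  have : ∀ᶠ x : ℝ in 𝓝 0, |x| < 1 := by
    have := (continuous_abs.tendsto (0 : ℝ)).eventually_lt_const (u := 1) (by simp)
    exact this
  filter_upwards [this] with x hx
  have h1 := Complex.norm_exp_sub_sum_le_norm_mul_exp (x * Complex.I) 3
  have h2 : ∑ m ∈ Finset.range 3, ((x : ℂ) * Complex.I) ^ m / (m.factorial : ℂ) =
      1 + x * Complex.I - x ^ 2 / 2 := by
    simp [Finset.sum_range_succ, mul_pow, Nat.factorial]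
    ring
  have h3 : ‖(x : ℂ) * Complex.I‖ = |x| := by simp
  rw [h2, h3] at h1
  refine h1.trans ?_
  rw [mul_comm, norm_pow, Real.norm_eq_abs]
  gcongr

/-! ### Independence of the blocks, and the Bernoulli limit theorem. -/

section Blocks

variable {Ω : Type*} [MeasurableSpace Ω] {P : Measure Ω} {k : ℕ} {X : ℕ → Ω → Fin k → ℝ}

/-- The observations in the block with index `b`. -/
def block (X : ℕ → Ω → Fin k → ℝ) (m b : ℕ) (ω : Ω) : Fin m → Fin k → ℝ :=
  fun i => X (i + b * m) ω

lemma injective_block_index (m : ℕ) :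
    Function.Injective (fun x : ℕ × Fin m => (x.2 : ℕ) + x.1 * m) := by
  rintro ⟨b, i⟩ ⟨b', i'⟩ h
  have hm : 0 < m := i.pos
  simp only at h
  have h1 : b = b' := by
    have := congrArg (· / m) h
    simpa [Nat.add_mul_div_right _ _ hm, Nat.div_eq_of_lt i.2, Nat.div_eq_of_lt i'.2] using this
  subst h1
  have h2 : (i : ℕ) = i' := by omega
  rw [Fin.ext h2]

/-- The data indexed by block and position have a product law; currying the index turns it into a
product over blocks of the block laws. -/
lemma iIndepFun_block (hXm : ∀ i, Measurable (X i)) (hX : iIndepFun X P) (m : ℕ) :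
    iIndepFun (fun b => block X m b) P := by
  have hP := hX.isProbabilityMeasure
  have hpm : ∀ i, IsProbabilityMeasure (P.map (X i)) := fun i =>
    Measure.isProbabilityMeasure_map (hXm i).aemeasurable
  have hbm : ∀ b, Measurable (block X m b) := fun b => measurable_pi_lambda _ fun i => hXm _
  have h1 := hX.precomp (injective_block_index m)
  have h2 := (iIndepFun_iff_map_fun_eq_infinitePi_map fun x => hXm _).1 h1
  rw [iIndepFun_iff_map_fun_eq_infinitePi_map hbm]
  have h3 : ∀ b, P.map (block X m b) =
      Measure.infinitePi (fun i : Fin m => P.map (X (i + b * m))) := fun b =>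
    (iIndepFun_iff_map_fun_eq_infinitePi_map (fun i : Fin m => hXm _)).1
      (h1.precomp (g := fun i : Fin m => (b, i)) (fun i j hij => (Prod.mk.inj hij).2))
  simp_rw [h3]
  rw [← Measure.infinitePi_map_curry (fun (b : ℕ) (i : Fin m) => P.map (X (i + b * m)))]
  refine Eq.trans ?_ (congrArg (Measure.map _) h2)
  rw [Measure.map_map (MeasurableEquiv.curry ℕ (Fin m) _).measurable
    (measurable_pi_lambda _ fun x => hXm _)]
  rfl

end Blocks

/-- Convergence of the characteristic functions of sums of centred Bernoulli variables. -/
lemma tendsto_bernoulli_charFun_pow {N : ℕ → ℕ} {a q : ℕ → ℝ} {p μ : ℝ}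
    (hN : Tendsto N atTop atTop) (ha : Tendsto (fun n => (N n : ℝ) * a n ^ 2) atTop (𝓝 1))
    (hq : Tendsto q atTop (𝓝 p))
    (hμ : Tendsto (fun n => (N n : ℝ) * a n * (q n - p)) atTop (𝓝 μ)) (t : ℝ) :
    Tendsto (fun n => ((1 - q n : ℂ) * Complex.exp ((-(t * a n * p) : ℝ) * Complex.I) +
        q n * Complex.exp ((t * a n * (1 - p) : ℝ) * Complex.I)) ^ N n) atTop
      (𝓝 (Complex.exp (t * μ * Complex.I - (p * (1 - p) : ℝ) * t ^ 2 / 2))) := by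
  have hNinv : Tendsto (fun n => ((N n : ℝ))⁻¹) atTop (𝓝 0) :=
    tendsto_inv_atTop_nhds_zero_nat.comp hN
  have ha0 : Tendsto a atTop (𝓝 0) := by
    have h1 := hNinv.mul ha
    rw [zero_mul] at h1
    have h2 : Tendsto (fun n => a n ^ 2) atTop (𝓝 0) := by
      refine h1.congr' ?_
      filter_upwards [hN.eventually_gt_atTop 0] with n hn
      rw [inv_mul_cancel_left₀ (by exact_mod_cast hn.ne')]
    have h3 := h2.sqrt
    rw [Real.sqrt_zero] at h3
    simp only [Real.sqrt_sq_eq_abs] at h3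
    exact (tendsto_zero_iff_abs_tendsto_zero _).2 h3
  let R : ℝ → ℂ := fun x => Complex.exp (x * Complex.I) - (1 + x * Complex.I - x ^ 2 / 2)
  have hR : ∀ c : ℝ, Tendsto (fun n => (N n : ℂ) * R (a n * c)) atTop (𝓝 0) := by
    intro c
    have h1 : Tendsto (fun n => a n * c) atTop (𝓝 0) := by simpa using ha0.mul_const c
    have h2 : (fun n => R (a n * c)) =O[atTop] (fun n => (a n * c) ^ 3) :=
      isBigO_cexp_sub.comp_tendsto h1
    have h3 : (fun n => (N n : ℂ)) =O[atTop] (fun n => (N n : ℝ)) :=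
      IsBigO.of_norm_eventuallyLE (Eventually.of_forall fun n => by simp)
    -- The cubic remainder is negligible because `N * a ^ 2 → 1` and `a → 0`.
    have h4 : Tendsto (fun n => (N n : ℝ) * (a n * c) ^ 3) atTop (𝓝 0) := by
      have := (ha.mul ha0).mul_const (c ^ 3)
      rw [mul_zero, zero_mul] at this
      exact this.congr fun n => by ring
    exact (h3.mul h2).trans_tendsto h4
  have hC : ∀ {f : ℕ → ℝ} {x : ℝ}, Tendsto f atTop (𝓝 x) →
      Tendsto (fun n => (f n : ℂ)) atTop (𝓝 (x : ℂ)) := fun hf =>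
    (Complex.continuous_ofReal.tendsto _).comp hf
  have hmain : Tendsto (fun n => (N n : ℂ) * ((1 - q n : ℂ) *
      Complex.exp ((-(t * a n * p) : ℝ) * Complex.I) +
        q n * Complex.exp ((t * a n * (1 - p) : ℝ) * Complex.I) - 1)) atTop
      (𝓝 (t * μ * Complex.I - (p * (1 - p) : ℝ) * t ^ 2 / 2)) := by
    have e1 := ((hC hq).const_sub 1).mul (hR (-(t * p)))
    have e2 := (hC hq).mul (hR (t * (1 - p)))
    have e3 := ((hC hμ).const_mul (t : ℂ)).mul_const Complex.I
    have e4 := (hC (ha.mul (((hq.const_sub 1).mul_const (p ^ 2)).add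
      (hq.mul_const ((1 - p) ^ 2))))).mul_const ((t : ℂ) ^ 2 / 2)
    have e5 := ((e1.add e2).add e3).sub e4
    -- The variance appears as `(1 - p) * p ^ 2 + p * (1 - p) ^ 2 = p * (1 - p)`.
    have e6 : ((1 - (p : ℂ)) * 0 + p * 0 + t * μ * Complex.I -
        ((1 * ((1 - p) * p ^ 2 + p * (1 - p) ^ 2) : ℝ) : ℂ) * ((t : ℂ) ^ 2 / 2)) =
        t * μ * Complex.I - (p * (1 - p) : ℝ) * t ^ 2 / 2 := by
      push_cast
      ring
    rw [e6] at e5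
    refine e5.congr fun n => ?_
    have h1 : a n * -(t * p) = -(t * a n * p) := by ring
    have h2 : a n * (t * (1 - p)) = t * a n * (1 - p) := by ring
    simp only [R, h1, h2]
    push_cast
    ring
  refine (tendsto_one_add_pow_exp hN hmain).congr fun n => ?_
  rw [add_sub_cancel]

/-! ### Bias and limit law of the block estimator. -/

section BlockEstimator

variable {Ω : Type*} {k : ℕ} {X : ℕ → Ω → Fin k → ℝ}

/-- The indicator of sample concurrence in a block. -/
noncomputable def blockIndicator (X : ℕ → Ω → Fin k → ℝ) (m b : ℕ) : Ω → ℝ :=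
  (block X m b ⁻¹' {x | SampleConcurrent x}).indicator 1

lemma blockEstimator_eq (n m : ℕ) (ω : Ω) :
    blockEstimator n m (fun i => X i ω) =
      (1 / ((n / m : ℕ) : ℝ)) * ∑ b ∈ Finset.range (n / m), blockIndicator X m b ω := by
  rw [blockEstimator]
  congr 1

variable [MeasurableSpace Ω] {P : Measure Ω}

lemma measureReal_sampleConcurrent_block (hXm : ∀ i, Measurable (X i)) (hX : iIndepFun X P)
    (hid : ∀ i, P.map (X i) = P.map (X 0)) (m b : ℕ) :
    P.real (block X m b ⁻¹' {x | SampleConcurrent x}) = sampleProb P X m := by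
  have hP := hX.isProbabilityMeasure
  have hbm : ∀ b, Measurable (block X m b) := fun b => measurable_pi_lambda _ fun i => hXm _
  have h1 : ∀ b, P.map (block X m b) = Measure.pi (fun _ : Fin m => P.map (X 0)) := by
    intro b
    have h2 := hX.precomp (g := fun i : Fin m => (i : ℕ) + b * m)
      (fun i j hij => Fin.ext (Nat.add_right_cancel hij))
    have h3 := (iIndepFun_iff_map_fun_eq_pi_map fun i => (hXm _).aemeasurable).1 h2
    simp_rw [hid] at h3
    exact h3
  have h4 : P.real (block X m 0 ⁻¹' {x | SampleConcurrent x}) = sampleProb P X m := by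
    have h5 : block X m 0 = fun ω (i : Fin m) => X i ω := by
      funext ω i
      simp [block]
    rw [h5]
    rfl
  rw [← h4, ← map_measureReal_apply (hbm b) measurableSet_sampleConcurrent,
    ← map_measureReal_apply (hbm 0) measurableSet_sampleConcurrent, h1, h1]

lemma measurableSet_block (hXm : ∀ i, Measurable (X i)) (m b : ℕ) :
    MeasurableSet (block X m b ⁻¹' {x | SampleConcurrent x}) :=
  (measurable_pi_lambda (block X m b) fun _ => hXm _) measurableSet_sampleConcurrent

lemma measurable_blockIndicator (hXm : ∀ i, Measurable (X i)) (m b : ℕ) :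
    Measurable (blockIndicator X m b) :=
  measurable_one.indicator (measurableSet_block hXm m b)

lemma charFun_map_blockIndicator_sub (hXm : ∀ i, Measurable (X i)) (hX : iIndepFun X P)
    (hid : ∀ i, P.map (X i) = P.map (X 0)) (m b : ℕ) (p t : ℝ) :
    charFun (P.map (fun ω => blockIndicator X m b ω - p)) t =
      (1 - sampleProb P X m : ℂ) * Complex.exp ((-(t * p) : ℝ) * Complex.I) +
        sampleProb P X m * Complex.exp ((t * (1 - p) : ℝ) * Complex.I) := by
  have hP := hX.isProbabilityMeasure
  have hS := measurableSet_block hXm m b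
  rw [charFun_apply_real, integral_map
    ((measurable_blockIndicator hXm m b).sub_const p).aemeasurable (by fun_prop)]
  have h1 : ∀ ω, Complex.exp (t * ((blockIndicator X m b ω - p : ℝ) : ℂ) * Complex.I) =
      Complex.exp ((-(t * p) : ℝ) * Complex.I) +
        (block X m b ⁻¹' {x | SampleConcurrent x}).indicator (fun _ =>
          Complex.exp ((t * (1 - p) : ℝ) * Complex.I) -
            Complex.exp ((-(t * p) : ℝ) * Complex.I)) ω := by
    intro ω
    by_cases hω : ω ∈ block X m b ⁻¹' {x | SampleConcurrent x}
    · rw [blockIndicator, Set.indicator_of_mem hω, Set.indicator_of_mem hω]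
      simp
    · rw [blockIndicator, Set.indicator_of_notMem hω, Set.indicator_of_notMem hω]
      simp
  simp_rw [h1]
  rw [integral_add (integrable_const _) ((integrable_const _).indicator hS),
    integral_indicator_const _ hS, measureReal_sampleConcurrent_block hXm hX hid]
  simp only [integral_const, probReal_univ, one_smul, Complex.real_smul]
  ring

lemma charFun_map_sum_blockIndicator (hXm : ∀ i, Measurable (X i)) (hX : iIndepFun X P)
    (hid : ∀ i, P.map (X i) = P.map (X 0)) (m N : ℕ) (a p t : ℝ) :
    charFun (P.map (fun ω => a * ∑ b ∈ Finset.range N, (blockIndicator X m b ω - p))) t =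
      ((1 - sampleProb P X m : ℂ) * Complex.exp ((-(t * a * p) : ℝ) * Complex.I) +
        sampleProb P X m * Complex.exp ((t * a * (1 - p) : ℝ) * Complex.I)) ^ N := by
  have hm : ∀ b, Measurable (fun ω => blockIndicator X m b ω - p) := fun b =>
    (measurable_blockIndicator hXm m b).sub_const p
  have hind : iIndepFun (fun b ω => blockIndicator X m b ω - p) P :=
    (iIndepFun_block hXm hX m).comp
      (fun _ x => {x | SampleConcurrent x}.indicator (1 : (Fin m → Fin k → ℝ) → ℝ) x - p)
      (fun _ => (measurable_one.indicator measurableSet_sampleConcurrent).sub_const p)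
  rw [charFun_map_mul_comp (Finset.measurable_sum _ fun b _ => hm b).aemeasurable,
    (hind.restrict _).charFun_map_fun_finsetSum_eq_prod (fun b _ => (hm b).aemeasurable),
    Finset.prod_apply]
  simp_rw [charFun_map_blockIndicator_sub hXm hX hid]
  rw [Finset.prod_const, Finset.card_range, mul_comm a t]

/-- The bias of the block estimator. -/
lemma tendsto_sqrt_mul_sub {f : ℕ → ℝ} {p c : ℝ} {r : ℕ} (hc : 0 < c)
    (hf : (fun m => f m - p) ~[atTop] (fun m : ℕ => c / (m : ℝ) ^ r))
    {m : ℕ → ℕ} {lam : ℝ≥0∞} (hlam : lam ≠ 0)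
    (hlim : Tendsto (fun n : ℕ =>
      ENNReal.ofReal ((m n : ℝ) / (n : ℝ) ^ (1 / (2 * (r : ℝ) + 1)))) atTop (𝓝 lam)) :
    Tendsto m atTop atTop ∧ Tendsto (fun n : ℕ => √((n : ℝ) / (m n : ℝ)) * (f (m n) - p)) atTop
      (𝓝 (ENNReal.ofReal c / lam ^ ((r : ℝ) + 1 / 2)).toReal) := by
  have he : 0 < 1 / (2 * (r : ℝ) + 1) := by positivity
  have hm : Tendsto m atTop atTop := by
    -- Any real `δ` with `0 < δ < lam` gives `m n ≥ δ * n ^ (1 / (2r+1))` eventually, also when `lam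
    -- = ∞`.
    obtain ⟨δ, hδ0, hδ⟩ := ENNReal.lt_iff_exists_real_btwn.1 (pos_iff_ne_zero.2 hlam)
    have hδ0' : 0 < δ := ENNReal.ofReal_pos.1 hδ.1
    have h1 : Tendsto (fun n : ℕ => δ * (n : ℝ) ^ (1 / (2 * (r : ℝ) + 1))) atTop atTop :=
      ((tendsto_rpow_atTop he).comp tendsto_natCast_atTop_atTop).const_mul_atTop hδ0'
    refine tendsto_natCast_atTop_iff.1 (tendsto_atTop_mono' _ ?_ h1)
    filter_upwards [hlim.eventually_const_lt hδ.2, eventually_gt_atTop 0] with n hn hn0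
    have hn0' : (0 : ℝ) < n := by exact_mod_cast hn0
    have := (ENNReal.ofReal_lt_ofReal_iff_of_nonneg hδ0).1 hn
    exact ((lt_div_iff₀ (Real.rpow_pos_of_pos hn0' _)).1 this).le
  refine ⟨hm, ?_⟩
  have hequiv : (fun n : ℕ => √((n : ℝ) / (m n : ℝ)) * (f (m n) - p)) ~[atTop]
      (fun n : ℕ => √((n : ℝ) / (m n : ℝ)) * (c / (m n : ℝ) ^ r)) :=
    IsEquivalent.refl.mul (hf.comp_tendsto hm)
  refine hequiv.symm.tendsto_nhds ?_
  have h2 : lam ^ ((r : ℝ) + 1 / 2) ≠ 0 := by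
    rw [Ne, ENNReal.rpow_eq_zero_iff_of_pos (by positivity)]
    exact hlam
  -- Working in `ℝ≥0∞` treats finite and infinite `lam` together, the quotient being `0` for `lam =
  -- ∞`.
  have h3 := (ENNReal.tendsto_toReal (ENNReal.div_ne_top ENNReal.ofReal_ne_top h2)).comp
    (ENNReal.Tendsto.const_div (a := ENNReal.ofReal c)
      ((ENNReal.continuous_rpow_const (y := (r : ℝ) + 1 / 2)).tendsto _ |>.comp hlim)
      (Or.inr ENNReal.ofReal_ne_top))
  refine h3.congr' ?_
  filter_upwards [eventually_gt_atTop 0, hm.eventually_gt_atTop 0] with n hn hmn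
  have hn' : (0 : ℝ) < n := by exact_mod_cast hn
  have hmn' : (0 : ℝ) < m n := by exact_mod_cast hmn
  have hx : 0 < (m n : ℝ) / (n : ℝ) ^ (1 / (2 * (r : ℝ) + 1)) := by positivity
  simp only [Function.comp_apply]
  rw [ENNReal.ofReal_rpow_of_pos hx, ← ENNReal.ofReal_div_of_pos (by positivity),
    ENNReal.toReal_ofReal (by positivity), Real.div_rpow hmn'.le (by positivity),
    ← Real.rpow_mul hn'.le, Real.rpow_add hmn', Real.rpow_natCast, Real.sqrt_eq_rpow,
    Real.div_rpow hn'.le hmn'.le]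
  have h4 : 1 / (2 * (r : ℝ) + 1) * (r + 1 / 2) = 1 / 2 := by field_simp
  rw [h4]
  field_simp

/-- The central limit theorem for the block estimator. -/
lemma tendstoInDistribution_blockEstimator [IsProbabilityMeasure P]
    (hXm : ∀ i, Measurable (X i)) (hX : iIndepFun X P)
    (hid : ∀ i, P.map (X i) = P.map (X 0)) {p μ : ℝ} (hp0 : 0 ≤ p) (hp1 : p ≤ 1) {m : ℕ → ℕ}
    (hnm : Tendsto (fun n : ℕ => (n : ℝ) / (m n : ℝ)) atTop atTop)
    (hp : Tendsto (fun n => sampleProb P X (m n)) atTop (𝓝 p))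
    (hμ : Tendsto (fun n : ℕ => √((n : ℝ) / (m n : ℝ)) * (sampleProb P X (m n) - p)) atTop
      (𝓝 μ)) :
    TendstoInDistribution
      (fun (n : ℕ) (ω : Ω) => √((n : ℝ) / (m n : ℝ)) *
        (blockEstimator n (m n) (fun i => X i ω) - p))
      atTop (id : ℝ → ℝ) (fun _ => P) (gaussianReal μ (p * (1 - p)).toNNReal) where
  forall_aemeasurable n := by
    simp_rw [blockEstimator_eq]
    exact ((((Finset.measurable_sum _ fun b _ => measurable_blockIndicator hXm (m n) b).const_mul
      _).sub_const _).const_mul _).aemeasurable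
  aemeasurable_limit := aemeasurable_id
  tendsto := by
    refine ProbabilityMeasure.tendsto_iff_tendsto_charFun.2 fun t => ?_
    change Tendsto (fun n => charFun (P.map _) t) atTop
      (𝓝 (charFun (Measure.map id (gaussianReal μ (p * (1 - p)).toNNReal)) t))
    rw [Measure.map_id, charFun_gaussianReal,
      Real.coe_toNNReal _ (mul_nonneg hp0 (sub_nonneg.2 hp1))]
    have hfloor : ∀ n, ((n / m n : ℕ) : ℝ) = ⌊(n : ℝ) / (m n : ℝ)⌋₊ := fun n => by
      rw [Nat.floor_div_eq_div]
    have hN : Tendsto (fun n => n / m n) atTop atTop := by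
      refine (tendsto_nat_floor_atTop.comp hnm).congr fun n => ?_
      exact (Nat.floor_div_eq_div n (m n))
    have hratio : Tendsto (fun n => ((n / m n : ℕ) : ℝ) / ((n : ℝ) / (m n : ℝ))) atTop (𝓝 1) := by
      refine (tendsto_nat_floor_div_atTop.comp hnm).congr fun n => ?_
      rw [hfloor]
      rfl
    -- With `N = [n/m]` the statistic is `a` times a sum of `N` terms, `a = √(n/m) / N`. Then `N * a
    -- ^ 2 = (n/m) / N → 1` absorbs the rounding, and `N * a = √(n/m)` keeps the bias exact.
    have ha : Tendsto (fun n => ((n / m n : ℕ) : ℝ) *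
        (√((n : ℝ) / (m n : ℝ)) / ((n / m n : ℕ) : ℝ)) ^ 2) atTop (𝓝 1) := by
      have := hratio.inv₀ one_ne_zero
      rw [inv_one] at this
      refine this.congr' ?_
      filter_upwards [hN.eventually_gt_atTop 0] with n hn
      have hn' : ((n / m n : ℕ) : ℝ) ≠ 0 := by exact_mod_cast hn.ne'
      rw [div_pow, Real.sq_sqrt (by positivity)]
      field_simp
    have hμ' : Tendsto (fun n => ((n / m n : ℕ) : ℝ) *
        (√((n : ℝ) / (m n : ℝ)) / ((n / m n : ℕ) : ℝ)) * (sampleProb P X (m n) - p)) atTop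
        (𝓝 μ) := by
      refine hμ.congr' ?_
      filter_upwards [hN.eventually_gt_atTop 0] with n hn
      have hn' : ((n / m n : ℕ) : ℝ) ≠ 0 := by exact_mod_cast hn.ne'
      rw [mul_div_cancel₀ _ hn']
    refine (tendsto_bernoulli_charFun_pow hN ha hp hμ' t).congr' ?_
    filter_upwards [hN.eventually_gt_atTop 0] with n hn
    have hn' : ((n / m n : ℕ) : ℝ) ≠ 0 := by exact_mod_cast hn.ne'
    rw [← charFun_map_sum_blockIndicator hXm hX hid]
    congr 2
    ext ω
    rw [blockEstimator_eq, Finset.sum_sub_distrib, Finset.sum_const, Finset.card_range,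
      nsmul_eq_mul]
    field_simp

end BlockEstimator

end Concurrence

theorem theorem5 {d k : ℕ} (hk : 2 ≤ k)
    -- the simple max-stable process `η` on the compact set `𝒳`, and the sites
    (𝒳 : Set (EuclideanSpace ℝ (Fin d))) (h𝒳 : IsCompact 𝒳)
    {Ω' : Type*} [MeasurableSpace Ω'] (Q : Measure Ω') [IsProbabilityMeasure Q]
    (ζ : ℕ → Ω' → ℝ) (Y : ℕ → 𝒳 → Ω' → ℝ)
    (hη : Concurrence.IsSpectralRepresentation Q ζ Y)
    (s : Fin k → 𝒳)
    -- increasing transformations of the margins (the identity if `X` is itself simple)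
    (h : Fin k → ℝ → ℝ) (hh : ∀ j, StrictMonoOn (h j) (Set.Ioi 0))
    -- the data: independent copies of the max-stable vector `X(s_j) = h_j(η(s_j))`
    {Ω : Type*} [MeasurableSpace Ω] (P : Measure Ω) [IsProbabilityMeasure P]
    (X : ℕ → Ω → Fin k → ℝ) (hXm : ∀ i, Measurable (X i)) (hXindep : iIndepFun X P)
    (hX : ∀ i, IdentDistrib (X i)
      (fun ω j => h j (Concurrence.maxStable ζ Y (s j) ω)) P Q)
    (p : ℝ) (hp : p = Concurrence.extremalProb Q ζ Y s) (hp0 : 0 < p) (hp1 : p < 1) :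
    ∃ (r : ℕ) (c : ℝ), 1 ≤ r ∧ r ≤ k - 1 ∧ 0 < c ∧ c ≤ 1 - p ∧
      (fun m : ℕ => Concurrence.sampleProb P X m - p) ~[atTop]
        (fun m : ℕ => c / (m : ℝ) ^ r) ∧
      ∀ (m : ℕ → ℕ) (lam : ℝ≥0∞), lam ≠ 0 →
        Tendsto (fun n : ℕ => (n : ℝ) / (m n : ℝ)) atTop atTop →
        Tendsto (fun n : ℕ =>
          ENNReal.ofReal ((m n : ℝ) / (n : ℝ) ^ (1 / (2 * (r : ℝ) + 1)))) atTop (𝓝 lam) →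
        TendstoInDistribution
          (fun (n : ℕ) (ω : Ω) => √((n : ℝ) / (m n : ℝ)) *
            (Concurrence.blockEstimator n (m n) (fun i => X i ω) - p))
          atTop (id : ℝ → ℝ) (fun _ => P)
          (gaussianReal (ENNReal.ofReal c / lam ^ ((r : ℝ) + 1 / 2)).toReal
            (p * (1 - p)).toNNReal) := by
  have hk0 : 0 < k := by omega
  have hv := hη.isSpectralVector s
  have hsum := Concurrence.IsSpectralVector.sum_measureReal_hitCount hv hk0
  -- Extremal concurrence means that a single point attains all the maxima, so `p` is the constant
  -- coefficient of the expansion.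
  have hpq : p = Q.real {ω | Concurrence.hitCount ζ (fun i ω j => Y i (s j) ω) ω =
      (0 + 1 : ℕ)} := by
    rw [hp, Concurrence.extremalProb, measureReal_def, measureReal_def,
      ← hv.measure_exists_forall_eq hk0]
    rfl
  obtain ⟨r, c, hr1, hrk, hc0, hc1, hequiv⟩ := Concurrence.exists_isEquivalent_of_eq_sum
    (fun n => measureReal_nonneg) hsum hk0 (hpq ▸ hp1)
    (f := fun m => Concurrence.sampleProb P X m)
    (fun m hm => hv.sampleProb_eq_sum hk0 hh hXm hXindep hX hm)
  rw [← hpq] at hc1 hequiv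
  refine ⟨r, c, hr1, hrk, hc0, hc1, hequiv, fun m lam hlam hnm hlim => ?_⟩
  obtain ⟨hm, hbias⟩ := Concurrence.tendsto_sqrt_mul_sub hc0 hequiv hlam hlim
  have hp0' : Tendsto (fun m : ℕ => Concurrence.sampleProb P X m) atTop (𝓝 p) := by
    have h1 : Tendsto (fun m : ℕ => c / (m : ℝ) ^ r) atTop (𝓝 0) :=
      ((tendsto_pow_atTop (by omega)).comp tendsto_natCast_atTop_atTop).const_div_atTop c
    simpa using (hequiv.symm.tendsto_nhds h1).add_const p
  exact Concurrence.tendstoInDistribution_blockEstimator hXm hXindep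
    (fun i => (hX i).map_eq.trans (hX 0).map_eq.symm) hp0.le hp1.le hnm (hp0'.comp hm) hbias
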